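/- Let $\Sigma$ be a finite alphabet. A hidden Markov model over $\Sigma$ with hidden states $S=\{1,\dots,n\}$ consists of a probability vector $\pi\in\mathbb R^{S}$, a row-stochastic matrix $M\in\mathbb R^{S\times S}$ and a row-stochastic matrix $E\in\mathbb R^{S\times\Sigma}$. Its process $(X_t)_{t\ge 1}$ starts in a state $s$ with probability $\pi_s$; in each step it emits the symbol $a$ with probability $E_{sa}$, where $s$ is its current state, and then moves to $s'$ with probability $M_{ss'}$. A quantum random walk parametrization over $\Sigma$ consists of a directed $K$-regular graph with vertex set $\Sigma$, whose edges are labelled $(a,x)$ with $a\in\Sigma$, $x\in\{1,\dots,K\}$, the edges leaving $a$ being the $(a,x)$, a unitary operator $U$ on $\mathbb C^{k}$, $k=K|\Sigma|$, with coordinates indexed by the edges, and $\psi_0\in\mathbb C^k$ with $\|\psi_0\|=1$. Its process $(X_t)_{t\ge1}$ starts with the wave function $\psi_0$; in each step the current $\psi$ is replaced by $U\psi$, the symbol $a$ is emitted with probability $\sum_x|(U\psi)_{(a,x)}|^2$, and then $U\psi$ is projected onto the coordinates $(a,x)$, $1\le x\le K$, and renormalized. Its state space is the real vector space of self-adjoint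 complex $k\times k$ matrices, of dimension $k^2$. Two processes with values in $\Sigma$ are equivalent if $\Pr(X_1=a_1,\dots,X_t=a_t)=\Pr(Y_1=a_1,\dots,Y_t=a_t)$ for all $t\ge 0$ and all $a_1,\dots,a_t\in\Sigma$. Theorem. There is an algorithm that, given two hidden Markov models over the same alphabet $\Sigma$, with $n_X$ and $n_Y$ hidden states, decides whether the two processes are equivalent, in $O(|\Sigma|\max\{n_X,n_Y\}^4)$ arithmetic operations. Likewise, there is an algorithm that, given two quantum random walk parametrizations over the same alphabet $\Sigma$, with state spaces of dimensions $n_X$ and $n_Y$, decides whether the two processes are equivalent, in $O(|\Sigma|\max\{n_X,n_Y\}^4)$ arithmetic operations. In both cases the implied constant is absolute, and the arithmetic is exact arithmetic on real numbers (on real and imaginary parts for quantum random walks), each operation having unit cost. -/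

import Mathlib

/-! ## Hidden Markov models -/

/-- A hidden Markov model with alphabet `Fin σ` and set of hidden states `Fin n`. -/
structure HMM (σ n : ℕ) where
  /-- initial probabilities -/
  init : Fin n → ℝ
  /-- transition probabilities: `trans s s'` is the probability to move from `s` to `s'` -/
  trans : Matrix (Fin n) (Fin n) ℝ
  /-- emission probabilities: `emit s a` is the probability that state `s` emits `a` -/
  emit : Matrix (Fin n) (Fin σ) ℝ
  init_nonneg : ∀ s, 0 ≤ init s
  init_sum : ∑ s, init s = 1
  trans_nonneg : ∀ s s', 0 ≤ trans s s'
  trans_sum : ∀ s, ∑ s', trans s s' = 1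
  emit_nonneg : ∀ s a, 0 ≤ emit s a
  emit_sum : ∀ s, ∑ a, emit s a = 1

namespace HMM

variable {σ n : ℕ}

/-- The probability that the process, being in the hidden state `s`, emits the word `w` during
its next `w.length` steps: it emits a symbol from `s`, moves to some state `s'`, emits from `s'`,
and so on. -/
def probFrom (M : HMM σ n) : Fin n → List (Fin σ) → ℝ
  | _, [] => 1
  | s, a :: w => M.emit s a * ∑ s', M.trans s s' * M.probFrom s' w

/-- The probability function of the process `(X_t)` given by `M`:
`M.prob [a₁, …, a_t] = Pr(X_1 = a₁, …, X_t = a_t)`. -/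
def prob (M : HMM σ n) (w : List (Fin σ)) : ℝ :=
  ∑ s, M.init s * M.probFrom s w

end HMM

/-! ## Quantum random walks -/

/-- A quantum random walk parametrization over the alphabet `Fin σ`. The directed graph has vertex
set `Fin σ`; each vertex `a` has exactly `K` outgoing edges, and they are labelled `(a, x)`,
`x : Fin K`; `head (a, x)` is the vertex that the edge `(a, x)` points to. Nothing else is asked of
the graph, so that `K`-regular graphs are included under every convention on in-degrees, loops and
parallel edges. -/
structure QRW (σ K : ℕ) where
  /-- the graph -/
  head : Fin σ × Fin K → Fin σ
  /-- the evolution operator -/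
  U : Matrix (Fin σ × Fin K) (Fin σ × Fin K) ℂ
  /-- the initial wave function -/
  ψ₀ : EuclideanSpace ℂ (Fin σ × Fin K)
  U_unitary : U ∈ Matrix.unitaryGroup (Fin σ × Fin K) ℂ
  norm_ψ₀ : ‖ψ₀‖ = 1

namespace QRW

variable {σ K : ℕ}

/-- Application of the evolution operator. -/
noncomputable def evolve (Q : QRW σ K) (ψ : EuclideanSpace ℂ (Fin σ × Fin K)) :
    EuclideanSpace ℂ (Fin σ × Fin K) :=
  WithLp.toLp 2 (Q.U.mulVec ψ.ofLp)

/-- The orthogonal projection onto the span of the basis vectors of the edges `(a, x)`. -/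
def project (a : Fin σ) (φ : EuclideanSpace ℂ (Fin σ × Fin K)) :
    EuclideanSpace ℂ (Fin σ × Fin K) :=
  WithLp.toLp 2 fun e => if e.1 = a then φ e else 0

/-- The collapse of a wave function after observation of `a`: project and renormalize. (It is the
zero vector if `a` had probability zero.) -/
noncomputable def collapse (a : Fin σ) (φ : EuclideanSpace ℂ (Fin σ × Fin K)) :
    EuclideanSpace ℂ (Fin σ × Fin K) :=
  ((‖project a φ‖⁻¹ : ℝ) : ℂ) • project a φ

/-- The probability that the walk, having the wave function `ψ`, emits the word `w` during its
next `w.length` steps: apply `U`, observe `a` with probability `∑ x, |(U ψ) (a, x)|²`, collapse,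
and go on. -/
noncomputable def probFrom (Q : QRW σ K) :
    EuclideanSpace ℂ (Fin σ × Fin K) → List (Fin σ) → ℝ
  | _, [] => 1
  | ψ, a :: w =>
      (∑ x, ‖Q.evolve ψ (a, x)‖ ^ 2) * Q.probFrom (collapse a (Q.evolve ψ)) w

/-- The probability function of the quantum random walk `(X_t)` given by `Q`:
`Q.prob [a₁, …, a_t] = Pr(X_1 = a₁, …, X_t = a_t)`. -/
noncomputable def prob (Q : QRW σ K) (w : List (Fin σ)) : ℝ :=
  Q.probFrom Q.ψ₀ w

/-- The dimension of the state space, the real vector space of self-adjoint complex matrices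
with rows and columns indexed by the edges. -/
noncomputable def stateSpaceDim (σ K : ℕ) : ℕ :=
  Module.finrank ℝ (selfAdjoint (Matrix (Fin σ × Fin K) (Fin σ × Fin K) ℂ))

end QRW

/-! ## Programs over the reals

A real RAM in structured form. Its memory consists of index registers holding natural numbers and
of two-dimensional arrays of real cells. A program is a finite object that has access to real
numbers only through exact arithmetic, rational constants and tests for zero. Every operation,
every read or write and every test is charged one unit. -/

namespace RealRAM

/-- A memory state: `idx x` is the content of the index register `x`, and `mem A i j` is the
content of the cell `[i][j]` of the array `A`. -/
structure State where
  idx : ℕ → ℕ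
  mem : ℕ → ℕ → ℕ → ℝ

/-- Index expressions. -/
inductive IExpr where
  | const (c : ℕ)
  | reg (x : ℕ)
  | add (e f : IExpr)
  | sub (e f : IExpr)
  | mul (e f : IExpr)

namespace IExpr

/-- Subtraction of indices is truncated at zero. -/
def eval (s : State) : IExpr → ℕ
  | const c => c
  | reg x => s.idx x
  | add e f => e.eval s + f.eval s
  | sub e f => e.eval s - f.eval s
  | mul e f => e.eval s * f.eval s

def cost : IExpr → ℕ
  | const _ => 1
  | reg _ => 1
  | add e f => e.cost + f.cost + 1
  | sub e f => e.cost + f.cost + 1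
  | mul e f => e.cost + f.cost + 1

end IExpr

/-- Real expressions; `cell A e f` is the content of the cell `[e][f]` of the array `A`. -/
inductive RExpr where
  | const (q : ℚ)
  | cell (A : ℕ) (e f : IExpr)
  | add (u v : RExpr)
  | sub (u v : RExpr)
  | mul (u v : RExpr)
  | div (u v : RExpr)

namespace RExpr

noncomputable def eval (s : State) : RExpr → ℝ
  | const q => (q : ℝ)
  | cell A e f => s.mem A (e.eval s) (f.eval s)
  | add u v => u.eval s + v.eval s
  | sub u v => u.eval s - v.eval s
  | mul u v => u.eval s * v.eval s
  | div u v => u.eval s / v.eval s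

/-- No division by zero occurs in the evaluation. -/
def Defined (s : State) : RExpr → Prop
  | const _ => True
  | cell _ _ _ => True
  | add u v => u.Defined s ∧ v.Defined s
  | sub u v => u.Defined s ∧ v.Defined s
  | mul u v => u.Defined s ∧ v.Defined s
  | div u v => u.Defined s ∧ v.Defined s ∧ v.eval s ≠ 0

def cost : RExpr → ℕ
  | const _ => 1
  | cell _ e f => e.cost + f.cost + 1
  | add u v => u.cost + v.cost + 1
  | sub u v => u.cost + v.cost + 1
  | mul u v => u.cost + v.cost + 1
  | div u v => u.cost + v.cost + 1

end RExpr

/-- Programs. -/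
inductive Program where
  /-- do nothing -/
  | skip
  /-- assign the value of `e` to the index register `x` -/
  | setIdx (x : ℕ) (e : IExpr)
  /-- assign the value of `u` to the cell `[e][f]` of the array `A` -/
  | setCell (A : ℕ) (e f : IExpr) (u : RExpr)
  | seq (P R : Program)
  /-- `if e < f then P else R` -/
  | ifLt (e f : IExpr) (P R : Program)
  /-- `if u = 0 then P else R` -/
  | ifZero (u : RExpr) (P R : Program)
  /-- `while e < f do P` -/
  | whileLt (e f : IExpr) (P : Program)

namespace State

def setIdx (s : State) (x v : ℕ) : State :=
  { s with idx := Function.update s.idx x v }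

noncomputable def setCell (s : State) (A i j : ℕ) (r : ℝ) : State :=
  { s with mem := fun A' i' j' => if A' = A ∧ i' = i ∧ j' = j then r else s.mem A' i' j' }

end State

/-- `Exec P s t s'`: started in the state `s`, the program `P` halts in the state `s'` after
exactly `t` units of cost, without any division by zero. -/
inductive Exec : Program → State → ℕ → State → Prop
  | skip (s : State) : Exec .skip s 1 s
  | setIdx (s : State) (x : ℕ) (e : IExpr) :
      Exec (.setIdx x e) s (e.cost + 1) (s.setIdx x (e.eval s))
  | setCell (s : State) (A : ℕ) (e f : IExpr) (u : RExpr) (hu : u.Defined s) :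
      Exec (.setCell A e f u) s (e.cost + f.cost + u.cost + 1)
        (s.setCell A (e.eval s) (f.eval s) (u.eval s))
  | seq {P R : Program} {s s₁ s₂ : State} {t₁ t₂ : ℕ}
      (hP : Exec P s t₁ s₁) (hR : Exec R s₁ t₂ s₂) : Exec (.seq P R) s (t₁ + t₂) s₂
  | ifLt_true {e f : IExpr} {P R : Program} {s s₁ : State} {t : ℕ}
      (h : e.eval s < f.eval s) (hP : Exec P s t s₁) :
      Exec (.ifLt e f P R) s (e.cost + f.cost + 1 + t) s₁
  | ifLt_false {e f : IExpr} {P R : Program} {s s₁ : State} {t : ℕ}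
      (h : ¬ e.eval s < f.eval s) (hR : Exec R s t s₁) :
      Exec (.ifLt e f P R) s (e.cost + f.cost + 1 + t) s₁
  | ifZero_true {u : RExpr} {P R : Program} {s s₁ : State} {t : ℕ} (hu : u.Defined s)
      (h : u.eval s = 0) (hP : Exec P s t s₁) :
      Exec (.ifZero u P R) s (u.cost + 1 + t) s₁
  | ifZero_false {u : RExpr} {P R : Program} {s s₁ : State} {t : ℕ} (hu : u.Defined s)
      (h : u.eval s ≠ 0) (hR : Exec R s t s₁) :
      Exec (.ifZero u P R) s (u.cost + 1 + t) s₁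
  | while_true {e f : IExpr} {P : Program} {s s₁ s₂ : State} {t₁ t₂ : ℕ}
      (h : e.eval s < f.eval s) (hP : Exec P s t₁ s₁)
      (hW : Exec (.whileLt e f P) s₁ t₂ s₂) :
      Exec (.whileLt e f P) s (e.cost + f.cost + 1 + t₁ + t₂) s₂
  | while_false {e f : IExpr} {P : Program} {s : State} (h : ¬ e.eval s < f.eval s) :
      Exec (.whileLt e f P) s (e.cost + f.cost + 1) s

/-- Runs are unique. -/
theorem Exec.unique {P : Program} {s s₁ s₂ : State} {t₁ t₂ : ℕ}
    (h₁ : Exec P s t₁ s₁) (h₂ : Exec P s t₂ s₂) : t₁ = t₂ ∧ s₁ = s₂ := by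
  induction h₁ generalizing t₂ s₂ with
  | skip s => cases h₂; exact ⟨rfl, rfl⟩
  | setIdx s x e => cases h₂; exact ⟨rfl, rfl⟩
  | setCell s A e f u hu => cases h₂; exact ⟨rfl, rfl⟩
  | seq hP hR ihP ihR =>
    cases h₂ with
    | seq hP' hR' =>
      obtain ⟨rfl, rfl⟩ := ihP hP'
      obtain ⟨rfl, rfl⟩ := ihR hR'
      exact ⟨rfl, rfl⟩
  | ifLt_true h hP ih =>
    cases h₂ with
    | ifLt_true h' hP' => obtain ⟨rfl, rfl⟩ := ih hP'; exact ⟨rfl, rfl⟩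
    | ifLt_false h' hP' => exact absurd h h'
  | ifLt_false h hP ih =>
    cases h₂ with
    | ifLt_true h' hP' => exact absurd h' h
    | ifLt_false h' hP' => obtain ⟨rfl, rfl⟩ := ih hP'; exact ⟨rfl, rfl⟩
  | ifZero_true hu h hP ih =>
    cases h₂ with
    | ifZero_true hu' h' hP' => obtain ⟨rfl, rfl⟩ := ih hP'; exact ⟨rfl, rfl⟩
    | ifZero_false hu' h' hP' => exact absurd h h'
  | ifZero_false hu h hP ih =>
    cases h₂ with
    | ifZero_true hu' h' hP' => exact absurd h' h
    | ifZero_false hu' h' hP' => obtain ⟨rfl, rfl⟩ := ih hP'; exact ⟨rfl, rfl⟩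
  | while_true h hP hW ihP ihW =>
    cases h₂ with
    | while_true h' hP' hW' =>
      obtain ⟨rfl, rfl⟩ := ihP hP'
      obtain ⟨rfl, rfl⟩ := ihW hW'
      exact ⟨rfl, rfl⟩
    | while_false h' => exact absurd h h'
  | while_false h =>
    cases h₂ with
    | while_true h' hP' hW' => exact absurd h' h
    | while_false h' => exact ⟨rfl, rfl⟩

/-- Started in the state `s`, the program `P` halts at a cost of at most `T`, with the answer `1`
in the index register `0` if `φ` holds and with the answer `0` there if `φ` fails. -/
def DecidesWithin (P : Program) (s : State) (T : ℕ) (φ : Prop) : Prop :=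
  ∃ (t : ℕ) (s' : State), Exec P s t s' ∧ t ≤ T ∧
    (φ → s'.idx 0 = 1) ∧ (¬ φ → s'.idx 0 = 0)

/-- A matrix as the content of an array, with zeros in the unused cells. -/
def matrixCells {m n : ℕ} (A : Fin m → Fin n → ℝ) (i j : ℕ) : ℝ :=
  if h : i < m ∧ j < n then A ⟨i, h.1⟩ ⟨j, h.2⟩ else 0

/-- A vector as the content of row `0` of an array. -/
def vectorCells {n : ℕ} (v : Fin n → ℝ) : ℕ → ℕ → ℝ :=
  matrixCells (m := 1) fun _ j => v j

/-- The initial contents of the index registers. -/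
def inputIdx (a b c : ℕ) : ℕ → ℕ
  | 0 => a
  | 1 => b
  | 2 => c
  | _ => 0

/-- The initial state for two hidden Markov models: the registers `0`, `1`, `2` hold the size of
the alphabet and the numbers of hidden states. -/
def hmmInput {σ m n : ℕ} (MX : HMM σ m) (MY : HMM σ n) : State where
  idx := inputIdx σ m n
  mem
    | 0 => vectorCells MX.init
    | 1 => matrixCells MX.trans
    | 2 => matrixCells MX.emit
    | 3 => vectorCells MY.init
    | 4 => matrixCells MY.trans
    | 5 => matrixCells MY.emit
    | _ => fun _ _ => 0

/-- The edge with a given number: the edge `(a, x)` has the number `a * K + x`. -/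
def edge {σ K : ℕ} (i : Fin (σ * K)) : Fin σ × Fin K := finProdFinEquiv.symm i

/-- The initial state for two quantum random walks: the registers `0`, `1`, `2` hold the size of
the alphabet and the numbers of edges per vertex, and complex numbers are given by their real and
imaginary parts. The graphs themselves are not made available to the program. -/
noncomputable def qrwInput {σ K L : ℕ} (QX : QRW σ K) (QY : QRW σ L) : State where
  idx := inputIdx σ K L
  mem
    | 0 => matrixCells fun i j => (QX.U (edge i) (edge j)).re
    | 1 => matrixCells fun i j => (QX.U (edge i) (edge j)).im
    | 2 => vectorCells fun i => (QX.ψ₀ (edge i)).re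
    | 3 => vectorCells fun i => (QX.ψ₀ (edge i)).im
    | 4 => matrixCells fun i j => (QY.U (edge i) (edge j)).re
    | 5 => matrixCells fun i j => (QY.U (edge i) (edge j)).im
    | 6 => vectorCells fun i => (QY.ψ₀ (edge i)).re
    | 7 => vectorCells fun i => (QY.ψ₀ (edge i)).im
    | _ => fun _ _ => 0

end RealRAM

/-! Both kinds of process are given by weighted automata: `Pr(a₁ … a_t) = v · A_{a₁} ⋯ A_{a_t} · f`
with a row vector `v`, one square matrix per letter and a column vector `f`. For a hidden Markov
model, `v` is the initial distribution, `A_a` has the entries `E_{ia} M_{ij}`, and `f` is constantly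
one (`weight_hmmMatrix`). For a quantum random walk the renormalizations cancel, so the probability
of a word is the squared norm of a vector that depends linearly on the initial wave function
(`QRW.probFrom_eq_sqNormAfter`). It is thus quadratic in the `D = 2k` real coordinates `x` of that
function and linear in `x ⊗ x`; this gives an automaton with `D² = 4k²` states and with the trace as
`f` (`QRW.weight_eq_prob`).

Two processes are equivalent iff the direct sum of their automata, with the second `f` negated,
gives weight zero to all words (`weight_blockSum`, `weight_neg`). Its number `N` of states is at
most a constant times the larger of the two given dimensions.

All weights vanish iff `f` annihilates the smallest subspace that contains `v` and is closed under
all maps `u ↦ u A_a`. The program keeps an echelon basis, which starts with `v`. A sweep multiplies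
each basis row by each matrix and inserts the products. A sweep that does not enlarge the span
proves it invariant, and dimensions are at most `N`, so `N + 1` sweeps suffice (`Saturation.succ`,
`Saturation.exists_invariant`). A product and its insertion cost `O(N²)` and a sweep has `σ N` of
them, so everything costs `O(σ N⁴)` (`zeroTestProg_runs`).

Correctness and cost of the programs are proved together, by a small program logic around `Runs`;
its main rule is `Runs.forLt`. -/

namespace RealRAM

/-! ## Reasoning about programs -/

namespace Program

/-- No assignment in the program goes to the index register `x`. -/
def keepsIdx : Program → ℕ → Bool
  | skip, _ => true
  | setIdx y _, x => x != y
  | setCell _ _ _ _, _ => true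
  | seq P R, x => P.keepsIdx x && R.keepsIdx x
  | ifLt _ _ P R, x => P.keepsIdx x && R.keepsIdx x
  | ifZero _ P R, x => P.keepsIdx x && R.keepsIdx x
  | whileLt _ _ P, x => P.keepsIdx x

/-- No assignment in the program goes to the array `A`. -/
def keepsMem : Program → ℕ → Bool
  | skip, _ => true
  | setIdx _ _, _ => true
  | setCell B _ _ _, A => A != B
  | seq P R, A => P.keepsMem A && R.keepsMem A
  | ifLt _ _ P R, A => P.keepsMem A && R.keepsMem A
  | ifZero _ P R, A => P.keepsMem A && R.keepsMem A
  | whileLt _ _ P, A => P.keepsMem A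

/-- `for x < y do P`, where the bound is the content of the register `y`. -/
def loopLt (x y : ℕ) (P : Program) : Program :=
  seq (setIdx x (.const 0))
    (whileLt (.reg x) (.reg y) (seq P (setIdx x (.add (.reg x) (.const 1)))))

/-- The states agree wherever `P` makes no assignment. -/
structure Same (P : Program) (s s' : State) : Prop where
  idx : ∀ x, P.keepsIdx x = true → s'.idx x = s.idx x
  mem : ∀ A, P.keepsMem A = true → s'.mem A = s.mem A

end Program

open Program

theorem Program.Same.refl (P : Program) (s : State) : P.Same s s :=
  ⟨fun _ _ => rfl, fun _ _ => rfl⟩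

theorem Program.Same.trans {P : Program} {s₁ s₂ s₃ : State} (h : P.Same s₁ s₂)
    (h' : P.Same s₂ s₃) : P.Same s₁ s₃ :=
  ⟨fun x hx => (h'.idx x hx).trans (h.idx x hx), fun A hA => (h'.mem A hA).trans (h.mem A hA)⟩

theorem Program.Same.of_imp {P R : Program} {s s' : State} (h : P.Same s s')
    (hi : ∀ x, R.keepsIdx x = true → P.keepsIdx x = true)
    (hm : ∀ A, R.keepsMem A = true → P.keepsMem A = true) : R.Same s s' :=
  ⟨fun x hx => h.idx x (hi x hx), fun A hA => h.mem A (hm A hA)⟩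

/-- A frame rule with a syntactic side condition. Since `keepsIdx` and `keepsMem` are Boolean,
`decide` settles the condition for concrete programs, and postconditions need to mention only the
arrays that change. -/
theorem Exec.same {P : Program} {s s' : State} {t : ℕ} (h : Exec P s t s') : P.Same s s' := by
  induction h with
  | skip s => exact .refl _ _
  | setIdx s x e =>
    refine ⟨fun y hy => ?_, fun _ _ => rfl⟩
    have : y ≠ x := by simpa [keepsIdx] using hy
    simp [State.setIdx, this]
  | setCell s A e f u hu =>
    refine ⟨fun _ _ => rfl, fun B hB => ?_⟩
    have : B ≠ A := by simpa [keepsMem] using hB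
    simp [State.setCell, this]
  | seq _ _ ihP ihR =>
    refine (ihP.of_imp ?_ ?_).trans (ihR.of_imp ?_ ?_) <;> simp +contextual [keepsIdx, keepsMem]
  | ifLt_true _ _ ih => refine ih.of_imp ?_ ?_ <;> simp +contextual [keepsIdx, keepsMem]
  | ifLt_false _ _ ih => refine ih.of_imp ?_ ?_ <;> simp +contextual [keepsIdx, keepsMem]
  | ifZero_true _ _ _ ih => refine ih.of_imp ?_ ?_ <;> simp +contextual [keepsIdx, keepsMem]
  | ifZero_false _ _ _ ih => refine ih.of_imp ?_ ?_ <;> simp +contextual [keepsIdx, keepsMem]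
  | while_true _ _ _ ihP ihW =>
    refine (ihP.of_imp ?_ ?_).trans ihW <;> simp +contextual [keepsIdx, keepsMem]
  | while_false _ => exact .refl _ _

/-- Started in `s`, the program halts at a cost of at most `c` with memory contents
satisfying `Q`. -/
def Runs (P : Program) (s : State) (c : ℕ) (Q : (ℕ → ℕ → ℕ → ℝ) → Prop) : Prop :=
  ∃ t s', Exec P s t s' ∧ t ≤ c ∧ Q s'.mem

theorem Runs.mono {P : Program} {s : State} {c c' : ℕ} {Q Q' : (ℕ → ℕ → ℕ → ℝ) → Prop}
    (h : Runs P s c Q) (hc : c ≤ c') (hQ : ∀ m, Q m → Q' m) : Runs P s c' Q' := by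
  obtain ⟨t, s', he, ht, hq⟩ := h
  exact ⟨t, s', he, ht.trans hc, hQ _ hq⟩

theorem Runs.cost_le {P : Program} {s : State} {c c' : ℕ} {Q : (ℕ → ℕ → ℕ → ℝ) → Prop}
    (h : Runs P s c Q) (hc : c ≤ c') : Runs P s c' Q :=
  h.mono hc fun _ => id

theorem Runs.and_same {P : Program} {s : State} {c : ℕ} {Q : (ℕ → ℕ → ℕ → ℝ) → Prop}
    (h : Runs P s c Q) :
    Runs P s c fun m => Q m ∧ ∀ A, P.keepsMem A = true → m A = s.mem A := by
  obtain ⟨t, s', he, ht, hq⟩ := h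
  exact ⟨t, s', he, ht, hq, he.same.mem⟩

theorem Runs.skip {s : State} {c : ℕ} {Q : (ℕ → ℕ → ℕ → ℝ) → Prop} (hc : 1 ≤ c)
    (h : Q s.mem) : Runs .skip s c Q :=
  ⟨1, s, .skip s, hc, h⟩

theorem Runs.setCell {s : State} {A : ℕ} {e f : IExpr} {u : RExpr} {c : ℕ}
    {Q : (ℕ → ℕ → ℕ → ℝ) → Prop} (hc : e.cost + f.cost + u.cost + 1 ≤ c) (hu : u.Defined s)
    (h : Q (s.setCell A (e.eval s) (f.eval s) (u.eval s)).mem) :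
    Runs (.setCell A e f u) s c Q :=
  ⟨_, _, .setCell s A e f u hu, hc, h⟩

theorem Runs.seq {P R : Program} {s : State} {c₁ c₂ : ℕ} {Q₁ Q : (ℕ → ℕ → ℕ → ℝ) → Prop}
    (hP : Runs P s c₁ Q₁) (hR : ∀ s₁, P.Same s s₁ → Q₁ s₁.mem → Runs R s₁ c₂ Q) :
    Runs (.seq P R) s (c₁ + c₂) Q := by
  obtain ⟨t₁, s₁, he₁, ht₁, hq₁⟩ := hP
  obtain ⟨t₂, s₂, he₂, ht₂, hq₂⟩ := hR s₁ he₁.same hq₁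
  exact ⟨_, s₂, he₁.seq he₂, by omega, hq₂⟩

theorem Runs.setIdx_seq {R : Program} {s : State} {x : ℕ} {e : IExpr} {c : ℕ}
    {Q : (ℕ → ℕ → ℕ → ℝ) → Prop} (hR : Runs R (s.setIdx x (e.eval s)) c Q) :
    Runs (.seq (.setIdx x e) R) s (e.cost + 1 + c) Q := by
  obtain ⟨t₂, s₂, he₂, ht₂, hq₂⟩ := hR
  exact ⟨_, s₂, .seq (.setIdx s x e) he₂, by omega, hq₂⟩

/-- As `Runs.setIdx_seq`, with the new state described by equations. -/
theorem Runs.setIdx_seq' {R : Program} {s : State} {x : ℕ} {e : IExpr} {c : ℕ}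
    {Q : (ℕ → ℕ → ℕ → ℝ) → Prop}
    (hR : ∀ s' : State, s'.mem = s.mem → s'.idx = Function.update s.idx x (e.eval s) →
      Runs R s' c Q) :
    Runs (.seq (.setIdx x e) R) s (e.cost + 1 + c) Q :=
  Runs.setIdx_seq (hR _ rfl rfl)

theorem Runs.ifZero {u : RExpr} {P R : Program} {s : State} {c : ℕ}
    {Q : (ℕ → ℕ → ℕ → ℝ) → Prop} (hu : u.Defined s)
    (hP : u.eval s = 0 → Runs P s c Q) (hR : u.eval s ≠ 0 → Runs R s c Q) :
    Runs (.ifZero u P R) s (u.cost + 1 + c) Q := by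
  by_cases h : u.eval s = 0
  · obtain ⟨t, s', he, ht, hq⟩ := hP h
    exact ⟨_, s', .ifZero_true hu h he, by omega, hq⟩
  · obtain ⟨t, s', he, ht, hq⟩ := hR h
    exact ⟨_, s', .ifZero_false hu h he, by omega, hq⟩

/-- The rule for `for`-loops: the invariant speaks about the memory only, the index registers
being under control by `Same`. -/
theorem Runs.forLt {x y n : ℕ} {P : Program} {s : State} {C m : ℕ}
    (Inv : ℕ → (ℕ → ℕ → ℕ → ℝ) → Prop) (hy : s.idx y = n) (hxy : y ≠ x)
    (hx : P.keepsIdx x = true) (hPy : P.keepsIdx y = true) (hn : 1 ≤ n) (hm : 1 ≤ m)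
    (h0 : Inv 0 s.mem)
    (step : ∀ i < n, ∀ s', (loopLt x y P).Same s s' → s'.idx x = i → Inv i s'.mem →
      Runs P s' (C * m) (Inv (i + 1))) :
    Runs (loopLt x y P) s ((C + 12) * (n * m)) (Inv n) := by
  have hidx : ∀ z, (loopLt x y P).keepsIdx z = true → P.keepsIdx z = true ∧ z ≠ x := by
    intro z hz
    simp only [loopLt, keepsIdx, Bool.and_eq_true, bne_iff_ne] at hz
    exact ⟨hz.2.1, hz.1⟩
  have hmem : ∀ A, (loopLt x y P).keepsMem A = P.keepsMem A := by
    intro A; simp [loopLt, keepsMem]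
  -- Induction on the number `k` of rounds still to come. Besides its body a round pays 3 for the
  -- test and 4 for the increment; the final, failing test pays 3.
  have key : ∀ k i s', i + k = n → (loopLt x y P).Same s s' → s'.idx x = i →
      s'.idx y = n → Inv i s'.mem →
      Runs (.whileLt (.reg x) (.reg y) (.seq P (.setIdx x (.add (.reg x) (.const 1))))) s'
        (k * (C * m + 7) + 3) (Inv n) := by
    intro k
    induction k with
    | zero =>
      intro i s' hi _ hx' hy' hInv
      refine ⟨_, s', .while_false ?_, ?_, ?_⟩
      · simp [IExpr.eval, hx', hy', ← hi]
      · simp [IExpr.cost]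
      · obtain rfl : i = n := by omega
        exact hInv
    | succ k ih =>
      intro i s' hi hs hx' hy' hInv
      obtain ⟨t, s₁, he, ht, hq⟩ := step i (by omega) s' hs hx' hInv
      have hx₁ : s₁.idx x = i := (he.same.idx x hx).trans hx'
      have hy₁ : s₁.idx y = n := (he.same.idx y hPy).trans hy'
      obtain ⟨t₂, s₂, he₂, ht₂, hq₂⟩ := ih (i + 1) (s₁.setIdx x (i + 1)) (by omega)
        ⟨fun z hz => by
            have := hidx z hz
            simp [State.setIdx, this.2, he.same.idx z this.1, hs.idx z hz],
          fun A hA => by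
            rw [← hs.mem A hA, ← he.same.mem A (by rwa [← hmem])]; rfl⟩
        (by simp [State.setIdx]) (by simp [State.setIdx, hxy, hy₁]) hq
      have he' : Exec (.setIdx x (.add (.reg x) (.const 1))) s₁ 4 (s₁.setIdx x (i + 1)) := by
        have := Exec.setIdx s₁ x (.add (.reg x) (.const 1))
        simpa [IExpr.eval, IExpr.cost, hx₁] using this
      refine ⟨_, s₂, .while_true ?_ (he.seq he') he₂, ?_, hq₂⟩
      · simp only [IExpr.eval, hx', hy']; omega
      · simp only [IExpr.cost]
        have : (k + 1) * (C * m + 7) = k * (C * m + 7) + (C * m + 7) := by ring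
        omega
  obtain ⟨t, s', he, ht, hq⟩ := key n 0 (s.setIdx x 0) (by omega)
    ⟨fun z hz => by simp [State.setIdx, (hidx z hz).2], fun _ _ => rfl⟩
    (by simp [State.setIdx]) (by simp [State.setIdx, hxy, hy]) h0
  refine ⟨_, s', .seq (.setIdx s x (.const 0)) he, ?_, hq⟩
  simp only [IExpr.cost]
  -- The overhead is `7 * n + 5`, which is at most `12 * (n * m)` because `n` and `m` are positive.
  have h1 : n ≤ n * m := Nat.le_mul_of_pos_right n hm
  nlinarith

/-- A loop that fills a row of an array. -/
theorem Runs.forLt_row {x y n A r : ℕ} {e : IExpr} {u : RExpr} {s : State} (g : ℕ → ℝ)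
    (hy : s.idx y = n) (hxy : y ≠ x) (hn : 1 ≤ n)
    (step : ∀ i < n, ∀ s', (loopLt x y (.setCell A e (.reg x) u)).Same s s' → s'.idx x = i →
      s'.mem A r i = s.mem A r i → e.eval s' = r ∧ u.Defined s' ∧ u.eval s' = g i) :
    Runs (loopLt x y (.setCell A e (.reg x) u)) s ((e.cost + u.cost + 14) * n)
      fun m => m A = fun i j => if i = r ∧ j < n then g j else s.mem A i j := by
  have := Runs.forLt (C := e.cost + u.cost + 2) (m := 1) (s := s) (x := x) (y := y)
    (P := .setCell A e (.reg x) u)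
    (fun k m => m A = fun i j => if i = r ∧ j < k then g j else s.mem A i j)
    hy hxy rfl rfl hn le_rfl (by simp) ?_
  · exact this.cost_le (by simp [add_assoc])
  · intro i hi s' hs hx hInv
    -- In round `i` the cell `i` is still untouched, so `u` may read the very cell that it
    -- overwrites.
    obtain ⟨h1, h2, h3⟩ := step i hi s' hs hx (by simp [hInv])
    refine Runs.setCell (by simp [IExpr.cost]; omega) h2 ?_
    funext i' j'
    simp only [State.setCell, IExpr.eval, h1, h3, hx, true_and, hInv]
    grind

/-- A loop that adds up numbers in a cell. -/
theorem Runs.forLt_sum {x y n A r c : ℕ} {e f : IExpr} {u : RExpr} {s : State} (g : ℕ → ℝ)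
    (hy : s.idx y = n) (hxy : y ≠ x) (hn : 1 ≤ n)
    (step : ∀ i < n, ∀ s', (loopLt x y (.setCell A e f (.add (.cell A e f) u))).Same s s' →
      s'.idx x = i →
      e.eval s' = r ∧ f.eval s' = c ∧ u.Defined s' ∧ u.eval s' = g i) :
    Runs (loopLt x y (.setCell A e f (.add (.cell A e f) u))) s
      ((2 * e.cost + 2 * f.cost + u.cost + 15) * n)
      fun m => m A = fun i j => if i = r ∧ j = c then s.mem A i j + ∑ k ∈ Finset.range n, g k
        else s.mem A i j := by
  have := Runs.forLt (C := 2 * e.cost + 2 * f.cost + u.cost + 3) (m := 1) (s := s) (x := x) (y := y)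
    (P := .setCell A e f (.add (.cell A e f) u))
    (fun k m => m A = fun i j => if i = r ∧ j = c then s.mem A i j + ∑ k ∈ Finset.range k, g k
        else s.mem A i j)
    hy hxy rfl rfl hn le_rfl (by simp) ?_
  · exact this.cost_le (by simp [add_assoc])
  · intro i hi s' hs hx hInv
    obtain ⟨h1, h2, h3, h4⟩ := step i hi s' hs hx
    refine Runs.setCell (by simp [RExpr.cost]; omega) ⟨trivial, h3⟩ ?_
    funext i' j'
    simp only [State.setCell, RExpr.eval, h1, h2, h4, true_and, hInv, Finset.sum_range_succ]
    split_ifs with h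
    · obtain ⟨rfl, rfl⟩ := h; ring
    · rfl

/-! ### Programs that store prescribed values -/

/-- The program writes into the array `A` only values prescribed by `Φ`, and it does so in all
cells of `S`. -/
def Fills (P : Program) (s : State) (c A : ℕ) (Φ : ℕ → ℕ → ℝ) (S : ℕ → ℕ → Prop) : Prop :=
  Runs P s c fun m => (∀ i j, m A i j = s.mem A i j ∨ m A i j = Φ i j) ∧
    ∀ i j, S i j → m A i j = Φ i j

theorem Fills.mono {P : Program} {s : State} {c c' A : ℕ} {Φ : ℕ → ℕ → ℝ} {S S' : ℕ → ℕ → Prop}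
    (h : Fills P s c A Φ S) (hc : c ≤ c') (hS : ∀ i j, S' i j → S i j) :
    Fills P s c' A Φ S' :=
  Runs.mono h hc fun _ hm => ⟨hm.1, fun i j hij => hm.2 i j (hS i j hij)⟩

theorem Fills.setCell {s : State} {A c : ℕ} {e f : IExpr} {u : RExpr} {Φ : ℕ → ℕ → ℝ}
    (hc : e.cost + f.cost + u.cost + 1 ≤ c) (hu : u.Defined s)
    (h : u.eval s = Φ (e.eval s) (f.eval s)) :
    Fills (.setCell A e f u) s c A Φ fun i j => i = e.eval s ∧ j = f.eval s := by
  refine Runs.setCell hc hu ⟨fun i j => ?_, fun i j hij => ?_⟩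
  · simp only [State.setCell]
    grind
  · simp only [State.setCell]
    grind

/-- Overwriting does no harm, since both programs take their values from the same `Φ`. -/
theorem Fills.seq {P R : Program} {s : State} {A c₁ c₂ : ℕ} {Φ : ℕ → ℕ → ℝ}
    {S₁ S₂ : ℕ → ℕ → Prop} (hP : Fills P s c₁ A Φ S₁)
    (hR : ∀ s', P.Same s s' → Fills R s' c₂ A Φ S₂) :
    Fills (.seq P R) s (c₁ + c₂) A Φ fun i j => S₁ i j ∨ S₂ i j := by
  refine Runs.seq hP fun s₁ hs hm => Runs.mono (hR s₁ hs) le_rfl fun m hm' => ⟨?_, ?_⟩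
  · intro i j
    have := hm.1 i j; have := hm'.1 i j; grind
  · intro i j hij
    have := hm.2 i j; have := hm'.1 i j; have := hm'.2 i j; grind

theorem Fills.forLt {x y n : ℕ} {P : Program} {s : State} {C m A : ℕ} {Φ : ℕ → ℕ → ℝ}
    {S : ℕ → ℕ → ℕ → Prop} (hy : s.idx y = n) (hxy : y ≠ x)
    (hx : P.keepsIdx x = true) (hPy : P.keepsIdx y = true) (hn : 1 ≤ n) (hm : 1 ≤ m)
    (step : ∀ i < n, ∀ s', (loopLt x y P).Same s s' → s'.idx x = i →
      Fills P s' (C * m) A Φ (S i)) :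
    Fills (loopLt x y P) s ((C + 12) * (n * m)) A Φ fun i j => ∃ k < n, S k i j := by
  refine Runs.forLt (fun k m => (∀ i j, m A i j = s.mem A i j ∨ m A i j = Φ i j) ∧
    ∀ i j, (∃ l < k, S l i j) → m A i j = Φ i j) hy hxy hx hPy hn hm (by simp) ?_
  intro k hk s' hs hxk hInv
  refine Runs.mono (step k hk s' hs hxk) le_rfl fun m hm' => ⟨?_, ?_⟩
  · intro i j
    have := hInv.1 i j; have := hm'.1 i j; grind
  · rintro i j ⟨l, hl, hS⟩
    have h1 := hInv.2 i j; have h2 := hm'.1 i j; have h3 := hm'.2 i j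
    rcases Nat.lt_succ_iff_lt_or_eq.mp hl with hl' | rfl
    · rw [h1 ⟨l, hl', hS⟩] at h2; simpa using h2
    · exact h3 hS

end RealRAM

/-! ## Weighted automata -/

section Automaton

open Finset

/-- The weight of a word in the weighted automaton with states `0, …, N - 1`, transition
matrices `A a`, final weights `f` and initial weights `v`. -/
def weight {σ : ℕ} (N : ℕ) (A : ℕ → ℕ → ℕ → ℝ) (f : ℕ → ℝ) : (ℕ → ℝ) → List (Fin σ) → ℝ
  | v, [] => ∑ i ∈ range N, v i * f i
  | v, a :: w => weight N A f (fun j => ∑ i ∈ range N, v i * A a i j) w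

/-- The first `N` entries of a sequence. -/
def firstEntries (N : ℕ) (v : ℕ → ℝ) : Fin N → ℝ := fun i => v i

/-- Multiplication of row vectors by the upper left `N × N` block of `M`. -/
def stepMap (N : ℕ) (M : ℕ → ℕ → ℝ) : (Fin N → ℝ) →ₗ[ℝ] (Fin N → ℝ) :=
  Matrix.vecMulLinear (Matrix.of fun i j : Fin N => M i j)

theorem stepMap_apply (N : ℕ) (M : ℕ → ℕ → ℝ) (v : Fin N → ℝ) (j : Fin N) :
    stepMap N M v j = ∑ i, v i * M i j := rfl

theorem stepMap_firstEntries (N : ℕ) (M : ℕ → ℕ → ℝ) (v : ℕ → ℝ) :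
    stepMap N M (firstEntries N v) = firstEntries N fun j => ∑ i ∈ range N, v i * M i j := by
  funext j
  simp [stepMap_apply, firstEntries, Finset.sum_range]

/-- The weight of a word as a linear functional of the initial weights. -/
def weightFunctional {σ : ℕ} (N : ℕ) (A : ℕ → ℕ → ℕ → ℝ) (f : ℕ → ℝ) :
    List (Fin σ) → (Fin N → ℝ) →ₗ[ℝ] ℝ
  | [] => ∑ i : Fin N, f i • LinearMap.proj i
  | a :: w => (weightFunctional N A f w).comp (stepMap N (A a))

/-- The link between infinite sequences, which is how the memory presents vectors, and linear
algebra in `Fin N → ℝ`. -/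
theorem weight_eq_weightFunctional {σ : ℕ} (N : ℕ) (A : ℕ → ℕ → ℕ → ℝ) (f v : ℕ → ℝ)
    (w : List (Fin σ)) : weight N A f v w = weightFunctional N A f w (firstEntries N v) := by
  induction w generalizing v with
  | nil => simp [weight, weightFunctional, firstEntries, Finset.sum_range, mul_comm]
  | cons a w ih => simp [weight, weightFunctional, ih, stepMap_firstEntries]

theorem weight_congr {σ : ℕ} (N : ℕ) (A : ℕ → ℕ → ℕ → ℝ) (f : ℕ → ℝ) {v v' : ℕ → ℝ}
    (h : ∀ i < N, v i = v' i) (w : List (Fin σ)) : weight N A f v w = weight N A f v' w := by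
  rw [weight_eq_weightFunctional, weight_eq_weightFunctional]
  congr 1
  funext i
  exact h i i.2

/-! ### Row spaces and the reduction of one vector -/

/-- The span of the first `N` rows of `B`, cut off after `N` entries. -/
def rowSpan (N : ℕ) (B : ℕ → ℕ → ℝ) : Submodule ℝ (Fin N → ℝ) :=
  Submodule.span ℝ (Set.range fun r : Fin N => firstEntries N (B r))

theorem row_mem_rowSpan {N : ℕ} (B : ℕ → ℕ → ℝ) {r : ℕ} (hr : r < N) :
    firstEntries N (B r) ∈ rowSpan N B :=
  Submodule.subset_span ⟨⟨r, hr⟩, rfl⟩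

theorem rowSpan_le {N : ℕ} {B : ℕ → ℕ → ℝ} {W : Submodule ℝ (Fin N → ℝ)}
    (h : ∀ r < N, firstEntries N (B r) ∈ W) : rowSpan N B ≤ W := by
  rw [rowSpan, Submodule.span_le]
  rintro _ ⟨r, rfl⟩
  exact h r r.2

/-- A row echelon form in which each nonzero row has its pivot on the diagonal. -/
structure Echelon (N : ℕ) (B : ℕ → ℕ → ℝ) : Prop where
  lower : ∀ r < N, ∀ i < r, B r i = 0
  row_zero : ∀ r < N, B r r = 0 → ∀ i < N, B r i = 0

theorem Echelon.firstEntries_eq_zero {N : ℕ} {B : ℕ → ℕ → ℝ} (h : Echelon N B) {r : ℕ}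
    (hr : r < N) (h0 : B r r = 0) : firstEntries N (B r) = 0 := by
  funext i
  exact h.row_zero r hr h0 i i.2

/-- The state `(B, v)` of the reduction of the vector `v₀` modulo the rows of `B₀`, after the first
`j` columns have been dealt with. -/
structure Reduction (N : ℕ) (B₀ : ℕ → ℕ → ℝ) (v₀ : ℕ → ℝ) (j : ℕ) (B : ℕ → ℕ → ℝ)
    (v : ℕ → ℝ) : Prop where
  echelon : Echelon N B
  entry_zero : ∀ i < j, i < N → v i = 0
  span_eq : rowSpan N B ⊔ Submodule.span ℝ {firstEntries N v} =
    rowSpan N B₀ ⊔ Submodule.span ℝ {firstEntries N v₀}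
  row_eq : ∀ r < N, B₀ r r ≠ 0 → ∀ i < N, B r i = B₀ r i

theorem Reduction.of_entry_zero {N : ℕ} {B₀ : ℕ → ℕ → ℝ} {v₀ : ℕ → ℝ} {j : ℕ} {B : ℕ → ℕ → ℝ}
    {v : ℕ → ℝ} (h : Reduction N B₀ v₀ j B v) (hv : v j = 0) :
    Reduction N B₀ v₀ (j + 1) B v := by
  refine ⟨h.echelon, fun i hi hN => ?_, h.span_eq, h.row_eq⟩
  rcases Nat.lt_succ_iff_lt_or_eq.mp hi with hi | rfl
  exacts [h.entry_zero i hi hN, hv]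

/-- The entries of `v` to the left of column `j` are already zero, so `v` fits into row `j` with its
pivot on the diagonal. That row was zero before, so the span loses nothing. -/
theorem Reduction.insert {N : ℕ} {B₀ : ℕ → ℕ → ℝ} {v₀ : ℕ → ℝ} {j : ℕ} {B B' : ℕ → ℕ → ℝ}
    {v v' : ℕ → ℝ} (h : Reduction N B₀ v₀ j B v) (hj : j < N) (hv : v j ≠ 0) (hB : B j j = 0)
    (hB' : ∀ r < N, ∀ i < N, B' r i = if r = j then v i else B r i)
    (hv' : ∀ i < N, v' i = 0) : Reduction N B₀ v₀ (j + 1) B' v' := by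
  have hrow : ∀ r < N, r ≠ j → firstEntries N (B' r) = firstEntries N (B r) := by
    intro r hr hrj
    funext i
    simp [firstEntries, hB' r hr i i.2, hrj]
  have hrowj : firstEntries N (B' j) = firstEntries N v := by
    funext i
    simp [firstEntries, hB' j hj i i.2]
  refine ⟨⟨fun r hr i hi => ?_, fun r hr h0 i hi => ?_⟩, fun i _ hi => hv' i hi, ?_, ?_⟩
  · rw [hB' r hr i (hi.trans hr)]
    split_ifs with hrj
    · exact h.entry_zero i (hrj ▸ hi) (hi.trans hr)
    · exact h.echelon.lower r hr i hi
  · rw [hB' r hr r hr] at h0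
    rw [hB' r hr i hi]
    split_ifs at h0 ⊢ with hrj
    · exact absurd (hrj ▸ h0) hv
    · exact h.echelon.row_zero r hr h0 i hi
  · rw [← h.span_eq]
    have h0 : firstEntries N v' = 0 := by funext i; exact hv' i i.2
    rw [h0, Submodule.span_zero_singleton, sup_bot_eq]
    apply le_antisymm
    · refine rowSpan_le fun r hr => ?_
      by_cases hrj : r = j
      · rw [hrj, hrowj]
        exact Submodule.mem_sup_right (Submodule.mem_span_singleton_self _)
      · rw [hrow r hr hrj]
        exact Submodule.mem_sup_left (row_mem_rowSpan B hr)
    · refine sup_le (rowSpan_le fun r hr => ?_) ?_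
      · by_cases hrj : r = j
        · rw [hrj, h.echelon.firstEntries_eq_zero hj hB]
          exact Submodule.zero_mem _
        · rw [← hrow r hr hrj]
          exact row_mem_rowSpan B' hr
      · rw [Submodule.span_singleton_le_iff_mem, ← hrowj]
        exact row_mem_rowSpan B' hj
  · intro r hr h0 i hi
    rw [hB' r hr i hi]
    split_ifs with hrj
    · subst hrj
      exact absurd (h.row_eq r hr h0 r hr ▸ hB) h0
    · exact h.row_eq r hr h0 i hi

/-- Row `j` vanishes to the left of its pivot, so clearing column `j` does not spoil the earlier
columns. The operation is reversible, hence the joint span stays the same. -/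
theorem Reduction.eliminate {N : ℕ} {B₀ : ℕ → ℕ → ℝ} {v₀ : ℕ → ℝ} {j : ℕ} {B : ℕ → ℕ → ℝ}
    {v v' : ℕ → ℝ} (h : Reduction N B₀ v₀ j B v) (hj : j < N) (hB : B j j ≠ 0)
    (hv' : ∀ i < N, v' i = v i - v j / B j j * B j i) : Reduction N B₀ v₀ (j + 1) B v' := by
  refine ⟨h.echelon, fun i hi hN => ?_, ?_, h.row_eq⟩
  · rw [hv' i hN]
    rcases Nat.lt_succ_iff_lt_or_eq.mp hi with hi | rfl
    · rw [h.entry_zero i hi hN, h.echelon.lower j hj i hi]; simp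
    · field_simp; simp
  · rw [← h.span_eq]
    have hrow := row_mem_rowSpan B hj
    have hvv : firstEntries N v' = firstEntries N v - (v j / B j j) • firstEntries N (B j) := by
      funext i
      simp [firstEntries, hv' i i.2]
    apply le_antisymm <;> refine sup_le le_sup_left ?_ <;>
      rw [Submodule.span_singleton_le_iff_mem]
    · rw [hvv]
      exact Submodule.sub_mem _
        (Submodule.mem_sup_right (Submodule.mem_span_singleton_self _))
        (Submodule.mem_sup_left (Submodule.smul_mem _ _ hrow))
    · rw [← sub_add_cancel (firstEntries N v) ((v j / B j j) • firstEntries N (B j)), ← hvv]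
      exact Submodule.add_mem _
        (Submodule.mem_sup_right (Submodule.mem_span_singleton_self _))
        (Submodule.mem_sup_left (Submodule.smul_mem _ _ hrow))

theorem Reduction.rowSpan_eq {N : ℕ} {B₀ : ℕ → ℕ → ℝ} {v₀ : ℕ → ℝ} {B : ℕ → ℕ → ℝ}
    {v : ℕ → ℝ} (h : Reduction N B₀ v₀ N B v) :
    rowSpan N B = rowSpan N B₀ ⊔ Submodule.span ℝ {firstEntries N v₀} := by
  have h0 : firstEntries N v = 0 := by funext i; exact h.entry_zero i i.2 i.2
  rw [← h.span_eq, h0, Submodule.span_zero_singleton, sup_bot_eq]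

/-! ### Sweeps and saturation -/

/-- The state of a sweep over the rows of `B₀` in which the products `B₀ j * A a` with `D j a` have
been inserted already. -/
structure Sweep (σ N : ℕ) (A : ℕ → ℕ → ℕ → ℝ) (W : Submodule ℝ (Fin N → ℝ))
    (B₀ : ℕ → ℕ → ℝ) (D : ℕ → ℕ → Prop) (B : ℕ → ℕ → ℝ) : Prop where
  echelon : Echelon N B
  le : rowSpan N B ≤ W
  row_eq : ∀ r < N, B₀ r r ≠ 0 → ∀ i < N, B r i = B₀ r i
  subset : rowSpan N B₀ ≤ rowSpan N B
  product_mem : ∀ j < N, ∀ a < σ, D j a →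
    stepMap N (A a) (firstEntries N (B₀ j)) ∈ rowSpan N B

theorem Sweep.start {σ N : ℕ} {A : ℕ → ℕ → ℕ → ℝ} {W : Submodule ℝ (Fin N → ℝ)}
    {B₀ : ℕ → ℕ → ℝ} (h : Echelon N B₀) (hW : rowSpan N B₀ ≤ W) :
    Sweep σ N A W B₀ (fun _ _ => False) B₀ :=
  ⟨h, hW, fun _ _ _ _ _ => rfl, le_rfl, fun _ _ _ _ => False.elim⟩

theorem Sweep.of_imp {σ N : ℕ} {A : ℕ → ℕ → ℕ → ℝ} {W : Submodule ℝ (Fin N → ℝ)}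
    {B₀ B : ℕ → ℕ → ℝ} {D D' : ℕ → ℕ → Prop} (h : Sweep σ N A W B₀ D B)
    (hD : ∀ j a, a < σ → D' j a → D j a) : Sweep σ N A W B₀ D' B :=
  { h with product_mem := fun j hj a ha hd => h.product_mem j hj a ha (hD j a ha hd) }

/-- The product is formed with the current row `j` of `B`, which may differ from that of `B₀`. If
the row of `B₀` is nonzero, both agree, because rows with a pivot never change; if it is zero, its
product is zero and lies in every span. Rows that entered during the sweep do no harm either, as `W`
is invariant. -/
theorem Sweep.insert {σ N : ℕ} {A : ℕ → ℕ → ℕ → ℝ} {W : Submodule ℝ (Fin N → ℝ)}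
    {B₀ B B' : ℕ → ℕ → ℝ} {D : ℕ → ℕ → Prop} {j a : ℕ} {v v' : ℕ → ℝ}
    (h : Sweep σ N A W B₀ D B) (hB₀ : Echelon N B₀)
    (hW : ∀ a < σ, ∀ u ∈ W, stepMap N (A a) u ∈ W) (hj : j < N) (ha : a < σ)
    (hv : firstEntries N v = stepMap N (A a) (firstEntries N (B j)))
    (hR : Reduction N B v N B' v') :
    Sweep σ N A W B₀ (fun j' a' => D j' a' ∨ (j' = j ∧ a' = a)) B' := by
  have hle : rowSpan N B ≤ rowSpan N B' := hR.rowSpan_eq ▸ le_sup_left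
  refine ⟨hR.echelon, ?_, ?_, h.subset.trans hle, ?_⟩
  · rw [hR.rowSpan_eq]
    refine sup_le h.le ?_
    rw [Submodule.span_singleton_le_iff_mem, hv]
    exact hW a ha _ (h.le (row_mem_rowSpan B hj))
  · intro r hr h0 i hi
    rw [hR.row_eq r hr (by rwa [h.row_eq r hr h0 r hr]) i hi, h.row_eq r hr h0 i hi]
  · rintro j' hj' a' ha' (hD | ⟨rfl, rfl⟩)
    · exact hle (h.product_mem j' hj' a' ha' hD)
    · by_cases h0 : B₀ j' j' = 0
      · rw [hB₀.firstEntries_eq_zero hj h0, map_zero]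
        exact Submodule.zero_mem _
      · have : firstEntries N (B₀ j') = firstEntries N (B j') := by
          funext i
          exact (h.row_eq j' hj h0 i i.2).symm
        rw [this, ← hv, hR.rowSpan_eq]
        exact Submodule.mem_sup_right (Submodule.mem_span_singleton_self _)

/-- The state after `r` sweeps: either the dimension of the row space is at least `r`, or the row
space contains an invariant subspace through the initial vector. -/
structure Saturation (σ N : ℕ) (A : ℕ → ℕ → ℕ → ℝ) (W : Submodule ℝ (Fin N → ℝ))
    (v : ℕ → ℝ) (r : ℕ) (B : ℕ → ℕ → ℝ) : Prop where
  echelon : Echelon N B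
  le : rowSpan N B ≤ W
  init_mem : firstEntries N v ∈ rowSpan N B
  progress : r ≤ Module.finrank ℝ (rowSpan N B) ∨ ∃ S ≤ rowSpan N B, firstEntries N v ∈ S ∧
    ∀ a < σ, ∀ u ∈ S, stepMap N (A a) u ∈ S

/-- A sweep that enlarges the row space raises its dimension. Otherwise the row space contains all
products of its own generators and is itself invariant. Recording an invariant subspace, rather than
invariance of the row space, makes later sweeps a matter of monotonicity. -/
theorem Saturation.succ {σ N : ℕ} {A : ℕ → ℕ → ℕ → ℝ} {W : Submodule ℝ (Fin N → ℝ)}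
    {v : ℕ → ℝ} {r : ℕ} {B₀ B : ℕ → ℕ → ℝ} {D : ℕ → ℕ → Prop} (h : Saturation σ N A W v r B₀)
    (hS : Sweep σ N A W B₀ D B) (hD : ∀ j < N, ∀ a < σ, D j a) :
    Saturation σ N A W v (r + 1) B := by
  refine ⟨hS.echelon, hS.le, hS.subset h.init_mem, ?_⟩
  rcases h.progress with hr | ⟨S, hS₁, hS₂⟩
  · rcases hS.subset.eq_or_lt with heq | hlt
    · refine .inr ⟨rowSpan N B, le_rfl, hS.subset h.init_mem, fun a ha => ?_⟩
      suffices rowSpan N B ≤ (rowSpan N B).comap (stepMap N (A a)) from fun u hu => this hu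
      conv_lhs => rw [← heq]
      exact rowSpan_le fun j hj => hS.product_mem j hj a ha (hD j hj a ha)
    · have := Submodule.finrank_lt_finrank_of_lt hlt
      exact .inl (by omega)
  · exact .inr ⟨S, hS₁.trans hS.subset, hS₂⟩

/-- The dimension of a subspace of `Fin N → ℝ` cannot reach `N + 1`. -/
theorem Saturation.exists_invariant {σ N : ℕ} {A : ℕ → ℕ → ℕ → ℝ}
    {W : Submodule ℝ (Fin N → ℝ)} {v : ℕ → ℝ} {B : ℕ → ℕ → ℝ}
    (h : Saturation σ N A W v (N + 1) B) :
    ∃ S ≤ rowSpan N B, firstEntries N v ∈ S ∧ ∀ a < σ, ∀ u ∈ S, stepMap N (A a) u ∈ S := by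
  refine h.progress.resolve_left fun hr => ?_
  have := (rowSpan N B).finrank_le
  rw [Module.finrank_fin_fun] at this
  omega

/-! ### Final weights and the vanishing of all weights -/

/-- The vectors with vanishing weights of all words. -/
def nullSpace (σ N : ℕ) (A : ℕ → ℕ → ℕ → ℝ) (f : ℕ → ℝ) : Submodule ℝ (Fin N → ℝ) :=
  ⨅ w : List (Fin σ), (weightFunctional N A f w).ker

theorem mem_nullSpace {σ N : ℕ} {A : ℕ → ℕ → ℕ → ℝ} {f : ℕ → ℝ} {u : Fin N → ℝ} :
    u ∈ nullSpace σ N A f ↔ ∀ w : List (Fin σ), weightFunctional N A f w u = 0 := by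
  simp [nullSpace]

theorem stepMap_mem_nullSpace {σ N : ℕ} {A : ℕ → ℕ → ℕ → ℝ} {f : ℕ → ℝ} {a : ℕ} (ha : a < σ)
    {u : Fin N → ℝ} (hu : u ∈ nullSpace σ N A f) : stepMap N (A a) u ∈ nullSpace σ N A f := by
  rw [mem_nullSpace] at hu ⊢
  exact fun w => hu (⟨a, ha⟩ :: w)

/-- All vectors reached from `v` by reading words stay in the invariant subspace, on which `f`
vanishes because it vanishes on the rows. -/
theorem Saturation.weight_eq_zero {σ N : ℕ} {A : ℕ → ℕ → ℕ → ℝ} {f v : ℕ → ℝ}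
    {W : Submodule ℝ (Fin N → ℝ)} {B : ℕ → ℕ → ℝ} (h : Saturation σ N A W v (N + 1) B)
    (hf : ∀ j < N, ∑ i ∈ range N, B j i * f i = 0) (w : List (Fin σ)) :
    weight N A f v w = 0 := by
  obtain ⟨S, hS, hv, hA⟩ := h.exists_invariant
  rw [weight_eq_weightFunctional]
  generalize firstEntries N v = u at hv
  induction w generalizing u with
  | nil =>
    have : rowSpan N B ≤ (weightFunctional (σ := σ) N A f []).ker := by
      refine rowSpan_le fun j hj => ?_
      rw [LinearMap.mem_ker, ← weight_eq_weightFunctional]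
      exact hf j hj
    exact this (hS hv)
  | cons a w ih => exact ih _ (hA a a.2 _ hv)

/-- The converse direction of the test: rows in the null space give weight zero to the empty word.
-/
theorem Saturation.final_eq_zero {σ N : ℕ} {A : ℕ → ℕ → ℕ → ℝ} {f v : ℕ → ℝ} {r : ℕ}
    {B : ℕ → ℕ → ℝ} (h : Saturation σ N A (nullSpace σ N A f) v r B) {j : ℕ} (hj : j < N) :
    ∑ i ∈ range N, B j i * f i = 0 := by
  have := mem_nullSpace.mp (h.le (row_mem_rowSpan B hj)) []
  rwa [← weight_eq_weightFunctional] at this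

end Automaton

/-! ## Zero testing for weighted automata

The program expects the number of letters in register `0`, the number `N` of states in register
`3`, `N + 1` in register `4`, the matrix of the letter `a` in the rows `a * N + i`, `i < N`, of
array `20`, the initial weights in array `22` and the final weights in array `23`. The echelon
form is built in array `21`, and array `24` receives a nonzero entry if some weight is nonzero. -/

namespace RealRAM

open Program

local notation "I0" => IExpr.const 0

/-- Reduce the vector in array `22` modulo the rows of array `21`, and insert what remains. -/
def insertProg : Program :=
  loopLt 10 3
    (.ifZero (.cell 22 I0 (.reg 10)) .skip
      (.ifZero (.cell 21 (.reg 10) (.reg 10))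
        (.seq (loopLt 11 3 (.setCell 21 (.reg 10) (.reg 11) (.cell 22 I0 (.reg 11))))
          (loopLt 11 3 (.setCell 22 I0 (.reg 11) (.const 0))))
        (.seq (.setCell 25 I0 I0 (.div (.cell 22 I0 (.reg 10)) (.cell 21 (.reg 10) (.reg 10))))
          (loopLt 11 3 (.setCell 22 I0 (.reg 11)
            (.sub (.cell 22 I0 (.reg 11)) (.mul (.cell 25 I0 I0) (.cell 21 (.reg 10) (.reg 11)))))))))

/-- Each column takes `O(N)`: nothing to do, a row to fill, or an elimination. The quotient is saved
in array `25` beforehand, because the elimination loop overwrites the entry in the pivot column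
while the quotient is still needed. -/
theorem insertProg_runs {s : State} {N : ℕ} (h3 : s.idx 3 = N) (hN : 1 ≤ N)
    (hE : Echelon N (s.mem 21)) :
    Runs insertProg s (100 * (N * N)) fun m =>
      Reduction N (s.mem 21) (s.mem 22 0) N (m 21) (m 22 0) := by
  refine (Runs.forLt (C := 80) (m := N)
    (fun j m => Reduction N (s.mem 21) (s.mem 22 0) j (m 21) (m 22 0)) h3 (by decide)
    (by decide) (by decide) hN hN ⟨hE, by simp, rfl, fun _ _ _ _ _ => rfl⟩ ?_).cost_le
    (Nat.mul_le_mul_right _ (by norm_num))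
  intro j hj s' hs hx hInv
  have h3' : s'.idx 3 = N := (hs.idx 3 (by decide)).trans h3
  refine (Runs.ifZero (c := 70 * N) (by exact trivial) (fun h0 => ?_) fun h0 => ?_).cost_le
    (by simp only [RExpr.cost, IExpr.cost]; omega)
  · refine Runs.skip (by omega) (hInv.of_entry_zero ?_)
    simpa [RExpr.eval, IExpr.eval, hx] using h0
  have hv : s'.mem 22 0 j ≠ 0 := by simpa [RExpr.eval, IExpr.eval, hx] using h0
  refine (Runs.ifZero (c := 60 * N) (by exact trivial) (fun h1 => ?_) fun h1 => ?_).cost_le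
    (by simp only [RExpr.cost, IExpr.cost]; omega)
  · have hB : s'.mem 21 j j = 0 := by simpa [RExpr.eval, IExpr.eval, hx] using h1
    refine (Runs.seq (c₁ := 30 * N) (c₂ := 30 * N) ((Runs.forLt_row (r := j) (s'.mem 22 0) h3'
      (by decide) hN ?_).cost_le ?_) ?_).cost_le (by omega)
    · intro i hi t ht hti _
      refine ⟨?_, trivial, ?_⟩
      · simp [IExpr.eval, ht.idx 10 (by decide), hx]
      · simp [RExpr.eval, IExpr.eval, hti, ht.mem 22 (by decide)]
    · simp only [RExpr.cost, IExpr.cost]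
      exact Nat.mul_le_mul_right _ (by norm_num)
    intro t ht hm
    refine ((Runs.forLt_row (r := 0) (fun _ => 0) ((ht.idx 3 (by decide)).trans h3')
      (by decide) hN ?_).and_same).mono ?_ ?_
    · intro i hi t' ht' _ _
      exact ⟨rfl, trivial, by simp [RExpr.eval]⟩
    · simp only [RExpr.cost, IExpr.cost]
      exact Nat.mul_le_mul_right _ (by norm_num)
    · rintro m ⟨hm', hm''⟩
      refine hInv.insert hj hv hB (fun r hr i hi => ?_) fun i hi => ?_
      · rw [hm'' 21 (by decide), hm]
        simp [hi]
      · simp [hm', hi]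
  · have hB : s'.mem 21 j j ≠ 0 := by simpa [RExpr.eval, IExpr.eval, hx] using h1
    refine (Runs.seq (c₁ := 10) (c₂ := 30 * N)
      (Q₁ := fun m => m 25 0 0 = s'.mem 22 0 j / s'.mem 21 j j ∧ m 21 = s'.mem 21 ∧
        m 22 = s'.mem 22)
      (Runs.setCell (by simp [RExpr.cost, IExpr.cost]) (by exact ⟨trivial, trivial, h1⟩) ?_) ?_).cost_le
      (by omega)
    · refine ⟨?_, ?_, ?_⟩
      · simp [State.setCell, RExpr.eval, IExpr.eval, hx]
      · funext i k; simp [State.setCell]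
      · funext i k; simp [State.setCell]
    rintro t ht ⟨hm25, hm21, hm22⟩
    refine ((Runs.forLt_row (r := 0)
      (fun i => s'.mem 22 0 i - s'.mem 22 0 j / s'.mem 21 j j * s'.mem 21 j i)
      ((ht.idx 3 (by decide)).trans h3') (by decide) hN ?_).and_same).mono ?_ ?_
    · intro i hi t' ht' hti hti'
      refine ⟨rfl, ⟨trivial, trivial, trivial⟩, ?_⟩
      simp [RExpr.eval, IExpr.eval, hti, hti', ht'.mem 25 (by decide), ht'.mem 21 (by decide),
        ht'.idx 10 (by decide), ht.idx 10 (by decide), hx, hm25, hm21, hm22]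
    · simp only [RExpr.cost, IExpr.cost]
      exact Nat.mul_le_mul_right _ (by norm_num)
    · rintro m ⟨hm', hm''⟩
      rw [hm'' 21 (by decide), hm21]
      exact hInv.eliminate hj hB fun i hi => by simp [hm', hi]

/-- Put the product of row `reg 14` of array `21` with the matrix of the letter `reg 15` into
array `22`. -/
def multiplyProg : Program :=
  loopLt 11 3
    (.seq (.setCell 22 I0 (.reg 11) (.const 0))
      (loopLt 12 3 (.setCell 22 I0 (.reg 11) (.add (.cell 22 I0 (.reg 11))
        (.mul (.cell 21 (.reg 14) (.reg 12))
          (.cell 20 (.add (.mul (.reg 15) (.reg 3)) (.reg 12)) (.reg 11)))))))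

theorem multiplyProg_runs {s : State} {N j a : ℕ} (h3 : s.idx 3 = N) (hN : 1 ≤ N)
    (hj : s.idx 14 = j) (ha : s.idx 15 = a) :
    Runs multiplyProg s (100 * (N * N)) fun m => ∀ i < N,
      m 22 0 i = ∑ p ∈ Finset.range N, s.mem 21 j p * s.mem 20 (a * N + p) i := by
  refine (Runs.forLt (C := 80) (m := N)
    (fun k m => ∀ i < k,
      m 22 0 i = ∑ p ∈ Finset.range N, s.mem 21 j p * s.mem 20 (a * N + p) i) h3 (by decide)
    (by decide) (by decide) hN hN (by simp) ?_).cost_le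
    (Nat.mul_le_mul_right _ (by norm_num))
  intro i hi s' hs hx hInv
  refine (Runs.seq (c₁ := 10) (c₂ := 50 * N) (Q₁ := fun m => m 22 0 i = 0 ∧
      ∀ k, k ≠ i → m 22 0 k = s'.mem 22 0 k)
    (Runs.setCell (by simp [RExpr.cost, IExpr.cost]) (by exact trivial) ?_) ?_).cost_le (by omega)
  · constructor
    · simp [State.setCell, RExpr.eval, IExpr.eval, hx]
    · intro k hk
      simp [State.setCell, IExpr.eval, hx, hk]
  rintro t ht ⟨hm0, hm1⟩
  refine (Runs.forLt_sum (r := 0) (c := i)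
    (fun p => s.mem 21 j p * s.mem 20 (a * N + p) i) (n := N) ?_ (by decide) hN ?_).mono ?_ ?_
  · rw [ht.idx 3 (by decide), hs.idx 3 (by decide), h3]
  · intro p hp t' ht' htp
    have h11 : t'.idx 11 = i := by rw [ht'.idx 11 (by decide), ht.idx 11 (by decide), hx]
    have h14 : t'.idx 14 = j := by
      rw [ht'.idx 14 (by decide), ht.idx 14 (by decide), hs.idx 14 (by decide), hj]
    have h15 : t'.idx 15 = a := by
      rw [ht'.idx 15 (by decide), ht.idx 15 (by decide), hs.idx 15 (by decide), ha]
    have h3' : t'.idx 3 = N := by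
      rw [ht'.idx 3 (by decide), ht.idx 3 (by decide), hs.idx 3 (by decide), h3]
    refine ⟨rfl, h11, ⟨trivial, trivial⟩, ?_⟩
    simp [RExpr.eval, IExpr.eval, h11, h14, h15, h3', htp, ht'.mem 20 (by decide),
      ht.mem 20 (by decide), hs.mem 20 (by decide), ht'.mem 21 (by decide),
      ht.mem 21 (by decide), hs.mem 21 (by decide)]
  · simp only [RExpr.cost, IExpr.cost]
    exact Nat.mul_le_mul_right _ (by norm_num)
  · intro m hm k hk
    rw [hm]
    by_cases hki : k = i
    · simp [hki, hm0]
    · simp [hki, hm1 k hki, hInv k (by omega)]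

/-- Insert the products of all rows of array `21` with all matrices. -/
def sweepProg : Program :=
  loopLt 14 3 (loopLt 15 0 (.seq multiplyProg insertProg))

/-- Each of the `N * σ` products costs at most `100 * N²` to form and `100 * N²` to insert; the two
loops add 12 each to the constant. -/
theorem sweepProg_runs {s : State} {σ N : ℕ} {A : ℕ → ℕ → ℕ → ℝ} {W : Submodule ℝ (Fin N → ℝ)}
    (h0 : s.idx 0 = σ) (h3 : s.idx 3 = N) (hσ : 1 ≤ σ) (hN : 1 ≤ N)
    (hA : ∀ a < σ, ∀ i < N, ∀ j < N, s.mem 20 (a * N + i) j = A a i j)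
    (hW : ∀ a < σ, ∀ u ∈ W, stepMap N (A a) u ∈ W)
    (hE : Echelon N (s.mem 21)) (hle : rowSpan N (s.mem 21) ≤ W) :
    Runs sweepProg s (224 * (N * (σ * (N * N)))) fun m =>
      Sweep σ N A W (s.mem 21) (fun j _ => j < N) (m 21) := by
  have hNN : 1 ≤ N * N := Nat.mul_pos hN hN
  refine Runs.forLt (C := 212) (m := σ * (N * N))
    (fun k m => Sweep σ N A W (s.mem 21) (fun j _ => j < k) (m 21)) h3 (by decide)
    (by decide) (by decide) hN (Nat.mul_pos hσ hNN) ?_ ?_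
  · exact (Sweep.start hE hle).of_imp (by simp)
  intro j hj s₁ hs₁ hx₁ hInv₁
  refine (Runs.forLt (C := 200) (m := N * N) (n := σ)
    (fun k m => Sweep σ N A W (s.mem 21) (fun j' a' => j' < j ∨ (j' = j ∧ a' < k)) (m 21))
    ((hs₁.idx 0 (by decide)).trans h0) (by decide) (by decide) (by decide) hσ hNN
    (hInv₁.of_imp (by simp)) ?_).mono le_rfl fun m hm => hm.of_imp fun j' a' ha' hj' => by omega
  intro a ha s₂ hs₂ hx₂ hInv₂
  have h3₂ : s₂.idx 3 = N := by rw [hs₂.idx 3 (by decide), hs₁.idx 3 (by decide), h3]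
  refine (Runs.seq (c₁ := 100 * (N * N)) (c₂ := 100 * (N * N)) (multiplyProg_runs h3₂ hN
    ((hs₂.idx 14 (by decide)).trans hx₁) hx₂) fun s₃ hs₃ hm₃ => ?_).cost_le (by omega)
  have hB : s₃.mem 21 = s₂.mem 21 := hs₃.mem 21 (by decide)
  refine (insertProg_runs ((hs₃.idx 3 (by decide)).trans h3₂) hN
    (hB ▸ hInv₂.echelon)).mono le_rfl fun m hm => ?_
  rw [hB] at hm
  refine (hInv₂.insert hE hW hj ha ?_ hm).of_imp fun j' a' _ h => by omega
  rw [stepMap_firstEntries]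
  funext i
  simp only [firstEntries]
  rw [hm₃ i i.2]
  refine Finset.sum_congr rfl fun p hp => ?_
  rw [hs₂.mem 20 (by decide), hs₁.mem 20 (by decide), hA a ha p (Finset.mem_range.mp hp) i i.2]

/-- Test whether the final weights annihilate the rows of array `21`. -/
def testProg : Program :=
  loopLt 10 3
    (.seq (.setCell 25 I0 I0 (.const 0))
      (.seq (loopLt 11 3 (.setCell 25 I0 I0 (.add (.cell 25 I0 I0)
          (.mul (.cell 21 (.reg 10) (.reg 11)) (.cell 23 I0 (.reg 11))))))
        (.ifZero (.cell 25 I0 I0) .skip (.setCell 24 I0 I0 (.const 1)))))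

theorem testProg_runs {s : State} {N : ℕ} (h3 : s.idx 3 = N) (hN : 1 ≤ N)
    (h24 : s.mem 24 0 0 = 0) :
    Runs testProg s (100 * (N * N)) fun m =>
      m 24 0 0 = 0 ↔ ∀ j < N, ∑ i ∈ Finset.range N, s.mem 21 j i * s.mem 23 0 i = 0 := by
  refine (Runs.forLt (C := 80) (m := N)
    (fun k m => m 24 0 0 = 0 ↔
      ∀ j < k, ∑ i ∈ Finset.range N, s.mem 21 j i * s.mem 23 0 i = 0) h3 (by decide)
    (by decide) (by decide) hN hN (by simp [h24]) ?_).cost_le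
    (Nat.mul_le_mul_right _ (by norm_num))
  intro j hj s' hs hx hInv
  refine (Runs.seq (c₁ := 10) (c₂ := 40 * N + 15) (Q₁ := fun m => m 25 0 0 = 0)
    (Runs.setCell (by simp [RExpr.cost, IExpr.cost]) (by exact trivial) ?_) ?_).cost_le (by omega)
  · simp [State.setCell, RExpr.eval, IExpr.eval]
  intro t ht hm0
  refine (Runs.seq (c₁ := 40 * N) (c₂ := 15)
    (Q₁ := fun m => m 25 0 0 = ∑ i ∈ Finset.range N, s.mem 21 j i * s.mem 23 0 i)
    ((Runs.forLt_sum (r := 0) (c := 0)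
    (fun i => s.mem 21 j i * s.mem 23 0 i) (n := N) ?_ (by decide) hN ?_).mono ?_ ?_) ?_)
  · rw [ht.idx 3 (by decide), hs.idx 3 (by decide), h3]
  · intro i hi t' ht' hti
    have h10 : t'.idx 10 = j := by rw [ht'.idx 10 (by decide), ht.idx 10 (by decide), hx]
    refine ⟨rfl, rfl, ⟨trivial, trivial⟩, ?_⟩
    simp [RExpr.eval, IExpr.eval, h10, hti, ht'.mem 21 (by decide),
      ht.mem 21 (by decide), hs.mem 21 (by decide), ht'.mem 23 (by decide),
      ht.mem 23 (by decide), hs.mem 23 (by decide)]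
  · simp only [RExpr.cost, IExpr.cost]
    exact Nat.mul_le_mul_right _ (by norm_num)
  · intro m hm
    simp [hm, hm0]
  intro t' ht' hsum
  have h24' : t'.mem 24 = s'.mem 24 := by rw [ht'.mem 24 (by decide), ht.mem 24 (by decide)]
  refine (Runs.ifZero (c := 10) (by exact trivial) (fun h => ?_) fun h => ?_).cost_le
    (by simp [RExpr.cost, IExpr.cost])
  · refine Runs.skip (by omega) ?_
    simp only [RExpr.eval, IExpr.eval, hsum] at h
    rw [h24', hInv]
    refine ⟨fun h' k hk => ?_, fun h' k hk => h' k (by omega)⟩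
    rcases Nat.lt_succ_iff_lt_or_eq.mp hk with hk | rfl
    exacts [h' k hk, h]
  · refine Runs.setCell (by simp [RExpr.cost, IExpr.cost]) trivial ?_
    simp only [RExpr.eval, IExpr.eval, hsum] at h
    simp only [State.setCell, RExpr.eval, IExpr.eval]
    simp only [and_self, if_true, Rat.cast_one, one_ne_zero, false_iff]
    exact fun h' => h (h' j (by omega))

/-- Decide whether all weights of a weighted automaton are zero. -/
def zeroTestProg : Program :=
  .seq insertProg (.seq (loopLt 13 4 sweepProg) testProg)

theorem zeroTestProg_runs {s : State} {σ N : ℕ} {A : ℕ → ℕ → ℕ → ℝ} {v f : ℕ → ℝ}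
    (h0 : s.idx 0 = σ) (h3 : s.idx 3 = N) (h4 : s.idx 4 = N + 1) (hσ : 1 ≤ σ) (hN : 1 ≤ N)
    (hA : ∀ a < σ, ∀ i < N, ∀ j < N, s.mem 20 (a * N + i) j = A a i j)
    (hv : ∀ i < N, s.mem 22 0 i = v i) (hf : ∀ i < N, s.mem 23 0 i = f i)
    (h21 : ∀ i j, s.mem 21 i j = 0) (h24 : s.mem 24 0 0 = 0) :
    Runs zeroTestProg s (672 * (σ * N ^ 4)) fun m =>
      m 24 0 0 = 0 ↔ ∀ w : List (Fin σ), weight N A f v w = 0 := by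
  classical
  -- `W` is the upper bound for the row space throughout the run. If all weights vanish, the null
  -- space is such a bound and makes the test succeed; otherwise no bound is needed and `⊤` will do.
  obtain ⟨W, hWA, hWv, hW⟩ : ∃ W : Submodule ℝ (Fin N → ℝ),
      (∀ a < σ, ∀ u ∈ W, stepMap N (A a) u ∈ W) ∧ firstEntries N v ∈ W ∧
      ((∀ w : List (Fin σ), weight N A f v w = 0) → W = nullSpace σ N A f) := by
    by_cases h : ∀ w : List (Fin σ), weight N A f v w = 0
    · refine ⟨nullSpace σ N A f, fun a ha u hu => stepMap_mem_nullSpace ha hu, ?_, fun _ => rfl⟩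
      rw [mem_nullSpace]
      exact fun w => (weight_eq_weightFunctional N A f v w).symm.trans (h w)
    · exact ⟨⊤, by simp, by simp, fun h' => absurd h' h⟩
  have hbot : rowSpan N (s.mem 21) = ⊥ := by
    rw [eq_bot_iff]
    refine rowSpan_le fun r _ => ?_
    rw [Submodule.mem_bot]
    funext i
    exact h21 r i
  -- `236 = 224 + 12` is a sweep inside its loop. With `N + 1 ≤ 2 * N` the constant becomes `2 * 236
  -- + 2 * 100 = 672`.
  have hcost : 100 * (N * N) + (236 * ((N + 1) * (N * (σ * (N * N)))) + 100 * (N * N)) ≤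
      672 * (σ * N ^ 4) := by
    have h1 : (N + 1) * (N * (σ * (N * N))) ≤ (2 * N) * (N * (σ * (N * N))) :=
      Nat.mul_le_mul_right _ (by omega)
    have h2 : (2 * N) * (N * (σ * (N * N))) = 2 * (σ * N ^ 4) := by ring
    have h3 : 1 * (N * N * 1) ≤ σ * (N * N * (N * N)) := by
      gcongr; exact Nat.mul_pos hN hN
    have h4 : σ * (N * N * (N * N)) = σ * N ^ 4 := by ring
    omega
  refine (Runs.seq (insertProg_runs h3 hN ⟨by simp [h21], by simp [h21]⟩)
    fun s₁ hs₁ hR => Runs.seq (Runs.forLt (C := 224) (m := N * (σ * (N * N)))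
      (fun r m => Saturation σ N A W v r (m 21)) (n := N + 1) ?_ (by decide) (by decide)
      (by decide) (by omega) ?_ ?_ ?_) fun s₂ hs₂ hS => ?_).cost_le hcost
  · rw [hs₁.idx 4 (by decide), h4]
  · exact Nat.mul_pos hN (Nat.mul_pos hσ (Nat.mul_pos hN hN))
  -- Insertion into the empty basis makes the row space the line through `v`.
  · have hvv : firstEntries N (s.mem 22 0) = firstEntries N v := by
      funext i; exact hv i i.2
    have hspan := hR.rowSpan_eq
    rw [hbot, bot_sup_eq, hvv] at hspan
    refine ⟨hR.echelon, ?_, ?_, .inl (Nat.zero_le _)⟩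
    · rwa [hspan, Submodule.span_singleton_le_iff_mem]
    · rw [hspan]
      exact Submodule.mem_span_singleton_self _
  · intro r hr t ht htr hInv
    refine (sweepProg_runs (A := A) (W := W) (σ := σ) (N := N) ?_ ?_ hσ hN ?_ hWA hInv.echelon
      hInv.le).mono le_rfl fun m hm => hInv.succ hm fun j hj _ _ => hj
    · rw [ht.idx 0 (by decide), hs₁.idx 0 (by decide), h0]
    · rw [ht.idx 3 (by decide), hs₁.idx 3 (by decide), h3]
    · rw [ht.mem 20 (by decide), hs₁.mem 20 (by decide)]
      exact hA
  · refine (testProg_runs (N := N) ?_ hN ?_).mono le_rfl fun m hm => ?_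
    · rw [hs₂.idx 3 (by decide), hs₁.idx 3 (by decide), h3]
    · rw [hs₂.mem 24 (by decide), hs₁.mem 24 (by decide), h24]
    rw [hm, hs₂.mem 23 (by decide), hs₁.mem 23 (by decide)]
    have hsum : ∀ j, ∑ i ∈ Finset.range N, s₂.mem 21 j i * s.mem 23 0 i =
        ∑ i ∈ Finset.range N, s₂.mem 21 j i * f i := fun j =>
      Finset.sum_congr rfl fun i hi => by rw [hf i (Finset.mem_range.mp hi)]
    simp only [hsum]
    refine ⟨fun h => hS.weight_eq_zero h, fun h j hj => ?_⟩
    rw [hW h] at hS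
    exact hS.final_eq_zero hj

/-- Turn the outcome of the test into the answer. -/
def answerProg : Program :=
  .ifZero (.cell 24 I0 I0) (.setIdx 0 (.const 1)) (.setIdx 0 (.const 0))

/-- The answer costs 6: a test for 4 and an assignment for 2. In both equivalence tests register `0`
holds the alphabet size up to this point. -/
theorem Runs.decidesWithin {P : Program} {s : State} {c T : ℕ} {φ : Prop}
    (h : Runs P s c fun m => m 24 0 0 = 0 ↔ φ) (hT : c + 6 ≤ T) :
    DecidesWithin (.seq P answerProg) s T φ := by
  obtain ⟨t, s', he, ht, hq⟩ := h
  by_cases h0 : s'.mem 24 0 0 = 0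
  · refine ⟨_, _, he.seq (.ifZero_true trivial h0 (.setIdx s' 0 (.const 1))), ?_, ?_, ?_⟩
    · simp only [RExpr.cost, IExpr.cost]; omega
    · simp [State.setIdx, IExpr.eval]
    · exact fun h => absurd (hq.mp h0) h
  · refine ⟨_, _, he.seq (.ifZero_false trivial h0 (.setIdx s' 0 (.const 0))), ?_, ?_, ?_⟩
    · simp only [RExpr.cost, IExpr.cost]; omega
    · exact fun h => absurd (hq.mpr h) h0
    · simp [State.setIdx, IExpr.eval]

end RealRAM

/-! ## Direct sums of weighted automata -/

section DirectSum

open Finset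

/-- The block diagonal matrix with blocks `M` and `M'`, the first one of size `d`. -/
def blockSum (d : ℕ) (M M' : ℕ → ℕ → ℝ) (i j : ℕ) : ℝ :=
  if i < d then if j < d then M i j else 0
  else if j < d then 0 else M' (i - d) (j - d)

/-- The concatenation of the first `d` entries of `v` with `v'`. -/
def joinVec (d : ℕ) (v v' : ℕ → ℝ) (i : ℕ) : ℝ :=
  if i < d then v i else v' (i - d)

theorem sum_joinVec_mul_joinVec (d d' : ℕ) (v v' f f' : ℕ → ℝ) :
    ∑ i ∈ range (d + d'), joinVec d v v' i * joinVec d f f' i =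
      ∑ i ∈ range d, v i * f i + ∑ i ∈ range d', v' i * f' i := by
  rw [sum_range_add]
  congr 1
  · refine sum_congr rfl fun i hi => ?_
    simp [joinVec, mem_range.mp hi]
  · refine sum_congr rfl fun i hi => ?_
    simp [joinVec]

theorem sum_joinVec_mul_blockSum (d d' : ℕ) (v v' : ℕ → ℝ) (M M' : ℕ → ℕ → ℝ) (j : ℕ) :
    ∑ i ∈ range (d + d'), joinVec d v v' i * blockSum d M M' i j =
      joinVec d (fun j => ∑ i ∈ range d, v i * M i j)
        (fun j => ∑ i ∈ range d', v' i * M' i j) j := by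
  -- A column of a block diagonal matrix is a concatenation in which one part is zero, so the
  -- formula for concatenated vectors applies.
  have : ∀ i, blockSum d M M' i j = joinVec d (fun i => if j < d then M i j else 0)
      (fun i => if j < d then 0 else M' i (j - d)) i := fun i => rfl
  simp only [this, sum_joinVec_mul_joinVec]
  by_cases hj : j < d <;> simp [joinVec, hj]

theorem weight_blockSum {σ : ℕ} (d d' : ℕ) (A A' : ℕ → ℕ → ℕ → ℝ) (f f' v v' : ℕ → ℝ)
    (w : List (Fin σ)) :
    weight (d + d') (fun a => blockSum d (A a) (A' a)) (joinVec d f f') (joinVec d v v') w =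
      weight d A f v w + weight d' A' f' v' w := by
  induction w generalizing v v' with
  | nil => exact sum_joinVec_mul_joinVec d d' v v' f f'
  | cons a w ih =>
    simp only [weight]
    rw [← ih]
    congr 1
    funext j
    exact sum_joinVec_mul_blockSum d d' v v' _ _ j

theorem weight_neg {σ : ℕ} (d : ℕ) (A : ℕ → ℕ → ℕ → ℝ) (f v : ℕ → ℝ) (w : List (Fin σ)) :
    weight d A (fun i => -f i) v w = -weight d A f v w := by
  induction w generalizing v with
  | nil => simp [weight]
  | cons a w ih => simp only [weight, ih]

/-- The matrices `blockSum d (A a) (A' a)`, of size `N`, one below the other. -/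
def stackedBlocks (N d : ℕ) (A A' : ℕ → ℕ → ℕ → ℝ) (r c : ℕ) : ℝ :=
  blockSum d (A (r / N)) (A' (r / N)) (r % N) c

theorem stackedBlocks_apply {N d : ℕ} {A A' : ℕ → ℕ → ℕ → ℝ} {a i : ℕ} (hi : i < N) (c : ℕ) :
    stackedBlocks N d A A' (a * N + i) c = blockSum d (A a) (A' a) i c := by
  have h1 : (a * N + i) / N = a := by
    rw [mul_comm, Nat.mul_add_div (by omega), Nat.div_eq_of_lt hi, add_zero]
  have h2 : (a * N + i) % N = i := by
    rw [mul_comm, Nat.mul_add_mod, Nat.mod_eq_of_lt hi]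
  rw [stackedBlocks, h1, h2]

end DirectSum

namespace RealRAM

open Program

/-- In an array that starts with zeros the zero entries of `Φ` need not be written. This covers the
off-diagonal blocks and, for quantum walks, the zeros of the tensor squares and of the trace. -/
theorem Fills.runs_of_zero {P : Program} {s : State} {c A : ℕ} {Φ : ℕ → ℕ → ℝ}
    {S D : ℕ → ℕ → Prop} (h : Fills P s c A Φ S) (h0 : ∀ i j, s.mem A i j = 0)
    (hS : ∀ i j, D i j → ¬ S i j → Φ i j = 0) :
    Runs P s c fun m => ∀ i j, D i j → m A i j = Φ i j := by
  refine Runs.mono h le_rfl fun m hm i j hD => ?_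
  by_cases hij : S i j
  · exact hm.2 i j hij
  · rcases hm.1 i j with h' | h'
    · rw [h', h0, hS i j hD hij]
    · exact h'

/-- The programs `PT`, `PV`, `PF` store the data of a weighted automaton; then its weights
are tested. -/
theorem Runs.load_zeroTest {PT PV PF : Program} {s : State} {cT cV cF σ N : ℕ}
    {A : ℕ → ℕ → ℕ → ℝ} {v f : ℕ → ℝ}
    (hT : Runs PT s cT fun m => ∀ a < σ, ∀ i < N, ∀ j < N, m 20 (a * N + i) j = A a i j)
    (hV : ∀ s', PT.Same s s' → Runs PV s' cV fun m => ∀ i < N, m 22 0 i = v i)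
    (hF : ∀ s', (PT.seq PV).Same s s' → Runs PF s' cF fun m => ∀ i < N, m 23 0 i = f i)
    (hmem : ∀ A ∈ [21, 24], (PT.seq (PV.seq PF)).keepsMem A = true)
    (hidx : ∀ x ∈ [0, 3, 4], (PT.seq (PV.seq PF)).keepsIdx x = true)
    (hPV : PV.keepsMem 20 = true) (hPF : PF.keepsMem 20 = true ∧ PF.keepsMem 22 = true)
    (h0 : s.idx 0 = σ) (h3 : s.idx 3 = N) (h4 : s.idx 4 = N + 1) (hσ : 1 ≤ σ) (hN : 1 ≤ N)
    (h21 : ∀ i j, s.mem 21 i j = 0) (h24 : s.mem 24 0 0 = 0) :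
    Runs (PT.seq (PV.seq (PF.seq zeroTestProg))) s (cT + (cV + (cF + 672 * (σ * N ^ 4))))
      fun m => m 24 0 0 = 0 ↔ ∀ w : List (Fin σ), weight N A f v w = 0 := by
  have hi : ∀ x ∈ [0, 3, 4],
      PT.keepsIdx x = true ∧ PV.keepsIdx x = true ∧ PF.keepsIdx x = true := by
    intro x hx
    simpa [keepsIdx] using hidx x hx
  have hm : ∀ A ∈ [21, 24],
      PT.keepsMem A = true ∧ PV.keepsMem A = true ∧ PF.keepsMem A = true := by
    intro A hA
    simpa [keepsMem] using hmem A hA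
  refine Runs.seq hT fun s₁ hs₁ hq₁ => Runs.seq (hV s₁ hs₁) fun s₂ hs₂ hq₂ =>
    Runs.seq (hF s₂ ?_) fun s₃ hs₃ hq₃ => ?_
  · refine (hs₁.of_imp ?_ ?_).trans (hs₂.of_imp ?_ ?_) <;>
      simp +contextual [keepsIdx, keepsMem]
  · have hI : ∀ x ∈ [0, 3, 4], s₃.idx x = s.idx x := fun x hx => by
      obtain ⟨a, b, c⟩ := hi x hx
      rw [hs₃.idx x c, hs₂.idx x b, hs₁.idx x a]
    have hM : ∀ A ∈ [21, 24], s₃.mem A = s.mem A := fun x hx => by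
      obtain ⟨a, b, c⟩ := hm x hx
      rw [hs₃.mem x c, hs₂.mem x b, hs₁.mem x a]
    refine zeroTestProg_runs ?_ ?_ ?_ hσ hN ?_ ?_ hq₃ ?_ ?_
    · rw [hI 0 (by simp), h0]
    · rw [hI 3 (by simp), h3]
    · rw [hI 4 (by simp), h4]
    · rw [hs₃.mem 20 hPF.1, hs₂.mem 20 hPV]
      exact hq₁
    · rw [hs₃.mem 22 hPF.2]
      exact hq₂
    · rw [hM 21 (by simp)]
      exact h21
    · rw [hM 24 (by simp), h24]

theorem matrixCells_coe {m n : ℕ} (A : Fin m → Fin n → ℝ) (i : Fin m) (j : Fin n) :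
    matrixCells A i j = A i j := by
  simp [matrixCells]

theorem vectorCells_coe {n : ℕ} (v : Fin n → ℝ) (j : Fin n) : vectorCells v 0 j = v j := by
  simp [vectorCells, matrixCells]

/-! ## Hidden Markov models -/

/-- The matrices of a hidden Markov model, with entries `Pr(emit a from i, move to j)`. -/
def hmmMatrix {σ n : ℕ} (M : HMM σ n) (a i j : ℕ) : ℝ :=
  matrixCells M.emit i a * matrixCells M.trans i j

/-- The forward recursion of `weight` against the backward recursion of `probFrom`. The induction
needs arbitrary `v`, since a step does not preserve probability vectors. -/
theorem weight_hmmMatrix_eq_sum {σ n : ℕ} (M : HMM σ n) (v : ℕ → ℝ) (w : List (Fin σ)) :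
    weight n (hmmMatrix M) (fun _ => 1) v w = ∑ s : Fin n, v s * M.probFrom s w := by
  induction w generalizing v with
  | nil => simp [weight, HMM.probFrom, Finset.sum_range]
  | cons a w ih =>
    simp only [weight, ih, HMM.probFrom, Finset.sum_range, hmmMatrix, Finset.mul_sum,
      Finset.sum_mul]
    rw [Finset.sum_comm]
    refine Finset.sum_congr rfl fun i _ => Finset.sum_congr rfl fun j _ => ?_
    rw [matrixCells_coe (fun i a => M.emit i a), matrixCells_coe (fun i j => M.trans i j)]
    ring

theorem weight_hmmMatrix {σ n : ℕ} (M : HMM σ n) (w : List (Fin σ)) :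
    weight n (hmmMatrix M) (fun _ => 1) (vectorCells M.init 0) w = M.prob w := by
  simp [weight_hmmMatrix_eq_sum, HMM.prob, vectorCells_coe]

/-- Store the matrices of one of the two models (the second one if `o` is true). -/
def hmmMatrixProg (o : Bool) : Program :=
  loopLt 10 0 (loopLt 11 (cond o 2 1) (loopLt 12 (cond o 2 1)
    (.setCell 20 (.add (.mul (.reg 10) (.reg 3)) (.add (.reg (cond o 1 5)) (.reg 11)))
      (.add (.reg (cond o 1 5)) (.reg 12))
      (.mul (.cell (cond o 5 2) (.reg 11) (.reg 10)) (.cell (cond o 4 1) (.reg 11) (.reg 12))))))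

/-- `k` is the position where the states of the model begin in the direct sum. In `hmmProg` it is
`0` for the first model, from the never assigned register `5`, and the number of states of the first
model for the second, from register `1`. -/
theorem hmmMatrixProg_fills {o : Bool} {s : State} {σ n N k : ℕ} {Φ : ℕ → ℕ → ℝ}
    (h0 : s.idx 0 = σ) (h3 : s.idx 3 = N) (hn : s.idx (cond o 2 1) = n)
    (hk : s.idx (cond o 1 5) = k) (hσ : 1 ≤ σ) (hn1 : 1 ≤ n)
    (hΦ : ∀ a < σ, ∀ i < n, ∀ j < n, Φ (a * N + (k + i)) (k + j) =
      s.mem (cond o 5 2) i a * s.mem (cond o 4 1) i j) :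
    Fills (hmmMatrixProg o) s (100 * (σ * (n * n))) 20 Φ fun r c =>
      ∃ a < σ, ∃ i < n, ∃ j < n, r = a * N + (k + i) ∧ c = k + j := by
  have hnn : 1 ≤ n * n := Nat.mul_pos hn1 hn1
  refine (Fills.forLt (C := 54) (m := n * n) h0 (by decide) (by cases o <;> decide)
    (by cases o <;> decide) hσ hnn fun a ha s₁ hs₁ hx₁ => ?_).mono
    (Nat.mul_le_mul_right _ (by norm_num)) fun _ _ => id
  refine (Fills.forLt (C := 42) (m := n) (n := n) ((hs₁.idx _ (by cases o <;> decide)).trans hn)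
    (by cases o <;> decide) (by cases o <;> decide) (by cases o <;> decide) hn1 hn1
    fun i hi s₂ hs₂ hx₂ => ?_)
  refine (Fills.forLt (C := 30) (m := 1) (n := n) (by
    rw [hs₂.idx _ (by cases o <;> decide), hs₁.idx _ (by cases o <;> decide), hn])
    (by cases o <;> decide) (by cases o <;> decide) (by cases o <;> decide) hn1 le_rfl
    fun j hj s₃ hs₃ hx₃ => ?_).mono (by simp) fun _ _ => id
  have h10 : s₃.idx 10 = a := by
    rw [hs₃.idx _ (by cases o <;> decide), hs₂.idx _ (by cases o <;> decide), hx₁]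
  have h11 : s₃.idx 11 = i := by rw [hs₃.idx _ (by cases o <;> decide), hx₂]
  have h3' : s₃.idx 3 = N := by
    rw [hs₃.idx _ (by cases o <;> decide), hs₂.idx _ (by cases o <;> decide),
      hs₁.idx _ (by cases o <;> decide), h3]
  have hk' : s₃.idx (cond o 1 5) = k := by
    rw [hs₃.idx _ (by cases o <;> decide), hs₂.idx _ (by cases o <;> decide),
      hs₁.idx _ (by cases o <;> decide), hk]
  have hE : s₃.mem (cond o 5 2) = s.mem (cond o 5 2) := by
    rw [hs₃.mem _ (by cases o <;> decide), hs₂.mem _ (by cases o <;> decide),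
      hs₁.mem _ (by cases o <;> decide)]
  have hM : s₃.mem (cond o 4 1) = s.mem (cond o 4 1) := by
    rw [hs₃.mem _ (by cases o <;> decide), hs₂.mem _ (by cases o <;> decide),
      hs₁.mem _ (by cases o <;> decide)]
  refine (Fills.setCell (by simp [RExpr.cost, IExpr.cost]) (by exact ⟨trivial, trivial⟩) ?_).mono
    le_rfl ?_
  · simp only [RExpr.eval, IExpr.eval, h10, h11, h3', hk', hE, hM, hx₃]
    exact (hΦ a ha i hi j hj).symm
  · simp only [IExpr.eval, h10, h11, h3', hk', hx₃]
    exact fun _ _ => id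

/-- Write the value of `u` into the cells of row `0` of `A` that belong to one of the models. -/
def hmmVectorProg (o : Bool) (A : ℕ) (u : RExpr) : Program :=
  loopLt 10 (cond o 2 1) (.setCell A (.const 0) (.add (.reg (cond o 1 5)) (.reg 10)) u)

theorem hmmVectorProg_fills {o : Bool} {s : State} {A n k : ℕ} {u : RExpr} {Φ : ℕ → ℕ → ℝ}
    (hn : s.idx (cond o 2 1) = n) (hk : s.idx (cond o 1 5) = k) (hn1 : 1 ≤ n)
    (hu : u.cost ≤ 20)
    (hΦ : ∀ j < n, ∀ s', (hmmVectorProg o A u).Same s s' → s'.idx 10 = j →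
      u.Defined s' ∧ u.eval s' = Φ 0 (k + j)) :
    Fills (hmmVectorProg o A u) s (50 * n) A Φ fun r c => ∃ j < n, r = 0 ∧ c = k + j := by
  refine (Fills.forLt (C := 30) (m := 1) hn (by cases o <;> decide) (by cases o <;> rfl)
    (by cases o <;> rfl) hn1 le_rfl fun j hj s₁ hs₁ hx₁ => ?_).mono (by omega) fun _ _ => id
  have hk' : s₁.idx (cond o 1 5) = k := by rw [hs₁.idx _ (by cases o <;> rfl), hk]
  obtain ⟨h1, h2⟩ := hΦ j hj s₁ hs₁ hx₁
  refine (Fills.setCell (by simp [IExpr.cost]; omega) h1 ?_).mono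
    le_rfl ?_
  · simp only [IExpr.eval, hk', hx₁, h2]
  · simp only [IExpr.eval, hk', hx₁]
    exact fun _ _ => id

/-- Equivalence test for hidden Markov models. -/
def hmmProg : Program :=
  .seq (.seq (.setIdx 3 (.add (.reg 1) (.reg 2))) (.seq (.setIdx 4 (.add (.reg 3) (.const 1)))
    (.seq (.seq (hmmMatrixProg false) (hmmMatrixProg true))
      (.seq (.seq (hmmVectorProg false 22 (.cell 0 (.const 0) (.reg 10)))
          (hmmVectorProg true 22 (.cell 3 (.const 0) (.reg 10))))
        (.seq (.seq (hmmVectorProg false 23 (.const 1)) (hmmVectorProg true 23 (.const (-1))))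
          zeroTestProg))))) answerProg

/-- An empty sum is not one. Positivity matters because the loop rules absorb their overhead into a
product of loop bounds. -/
theorem _root_.HMM.card_pos {σ n : ℕ} (M : HMM σ n) : 1 ≤ n := by
  rcases Nat.eq_zero_or_pos n with rfl | h
  · simpa using M.init_sum
  · exact h

theorem _root_.HMM.card_alphabet_pos {σ n : ℕ} (M : HMM σ n) : 1 ≤ σ := by
  rcases Nat.eq_zero_or_pos σ with rfl | h
  · simpa using M.emit_sum ⟨0, M.card_pos⟩
  · exact h

theorem hmmProg_decidesWithin {σ m n : ℕ} (MX : HMM σ m) (MY : HMM σ n) :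
    DecidesWithin hmmProg (hmmInput MX MY) (20000 * (σ * max m n ^ 4)) (MX.prob = MY.prob) := by
  have hm := MX.card_pos
  have hn := MY.card_pos
  have hσ := MX.card_alphabet_pos
  set A : ℕ → ℕ → ℕ → ℝ := fun a => blockSum m (hmmMatrix MX a) (hmmMatrix MY a) with hA
  set v := joinVec m (vectorCells MX.init 0) (vectorCells MY.init 0) with hv
  set f := joinVec m (fun _ => 1) (fun _ => -1) with hf
  have hiff : MX.prob = MY.prob ↔ ∀ w : List (Fin σ), weight (m + n) A f v w = 0 := by
    rw [funext_iff]
    refine forall_congr' fun w => ?_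
    rw [hA, hf, hv, weight_blockSum, weight_neg n _ (fun _ => 1), weight_hmmMatrix,
      weight_hmmMatrix, ← sub_eq_add_neg, sub_eq_zero]
  rw [hiff]
  refine Runs.decidesWithin (Runs.setIdx_seq (Runs.setIdx_seq (Runs.load_zeroTest
    (cT := 100 * (σ * (m * m)) + 100 * (σ * (n * n))) (cV := 50 * m + 50 * n)
    (cF := 50 * m + 50 * n) ?_ ?_ ?_ (by decide) (by decide) (by decide) (by decide)
    rfl rfl rfl hσ (by omega) (fun _ _ => rfl) rfl))) ?_
  · refine ((Fills.seq (hmmMatrixProg_fills (o := false) (σ := σ) (n := m) (N := m + n) (k := 0)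
      (Φ := stackedBlocks (m + n) m (hmmMatrix MX) (hmmMatrix MY)) rfl rfl rfl rfl hσ hm ?_)
      fun s' hs' => hmmMatrixProg_fills (o := true) (σ := σ) (n := n) (N := m + n) (k := m)
        (by exact hs'.idx 0 (by decide)) (by exact hs'.idx 3 (by decide))
        (by exact hs'.idx 2 (by decide)) (by exact hs'.idx 1 (by decide)) hσ hn ?_).runs_of_zero
      (D := fun r c => ∃ a < σ, ∃ i < m + n, ∃ j < m + n, r = a * (m + n) + i ∧ c = j)
      (fun _ _ => rfl) ?_).mono le_rfl ?_
    · intro a _ i hi j hj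
      rw [stackedBlocks_apply (by omega)]
      simp [blockSum, hi, hj]
      rfl
    · intro a _ i hi j hj
      rw [stackedBlocks_apply (by omega)]
      simp only [cond_true]
      rw [hs'.mem 5 (by decide), hs'.mem 4 (by decide)]
      simp [blockSum]
      rfl
    -- Cells that neither program writes lie in off-diagonal blocks.
    · rintro r c ⟨a, ha, i, hi, j, hj, rfl, rfl⟩ hS
      rw [stackedBlocks_apply hi]
      simp only [blockSum]
      split_ifs with h1 h2 h2
      · exact absurd (.inl ⟨a, ha, i, h1, c, h2, by simp, by simp⟩) hS
      · rfl
      · rfl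
      · refine absurd (.inr ⟨a, ha, i - m, by omega, c - m, by omega, ?_, by omega⟩) hS
        congr 1; omega
    · intro M hM a ha i hi j hj
      rw [hM _ _ ⟨a, ha, i, hi, j, hj, rfl, rfl⟩, stackedBlocks_apply hi]
  · intro s hs
    refine ((Fills.seq (hmmVectorProg_fills (o := false) (n := m) (k := 0) (Φ := fun _ => v)
      (hs.idx 1 (by decide)) (hs.idx 5 (by decide)) hm (by decide) ?_)
      fun s' hs' => hmmVectorProg_fills (o := true) (n := n) (k := m)
        ((hs'.idx 2 (by decide)).trans (hs.idx 2 (by decide)))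
        ((hs'.idx 1 (by decide)).trans (hs.idx 1 (by decide))) hn (by decide) ?_).runs_of_zero
      (D := fun r c => r = 0 ∧ c < m + n) ?_ ?_).mono le_rfl
      fun M hM i hi => hM 0 i ⟨rfl, hi⟩
    · intro j hj t ht htj
      refine ⟨trivial, ?_⟩
      simp only [RExpr.eval, IExpr.eval, htj]
      rw [ht.mem 0 (by decide), hs.mem 0 (by decide)]
      simp [hv, joinVec, hj]
      rfl
    · intro j hj t ht htj
      refine ⟨trivial, ?_⟩
      simp only [RExpr.eval, IExpr.eval, htj]
      rw [ht.mem 3 (by decide), hs'.mem 3 (by decide), hs.mem 3 (by decide)]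
      simp [hv, joinVec]
      rfl
    · intro i j
      rw [hs.mem 22 (by decide)]
      rfl
    · rintro r c ⟨rfl, hc⟩ hS
      exfalso
      by_cases h : c < m
      · exact hS (.inl ⟨c, h, rfl, by simp⟩)
      · exact hS (.inr ⟨c - m, by omega, rfl, by omega⟩)
  · intro s hs
    refine ((Fills.seq (hmmVectorProg_fills (o := false) (n := m) (k := 0) (Φ := fun _ => f)
      (hs.idx 1 (by decide)) (hs.idx 5 (by decide)) hm (by decide) ?_)
      fun s' hs' => hmmVectorProg_fills (o := true) (n := n) (k := m)
        ((hs'.idx 2 (by decide)).trans (hs.idx 2 (by decide)))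
        ((hs'.idx 1 (by decide)).trans (hs.idx 1 (by decide))) hn (by decide) ?_).runs_of_zero
      (D := fun r c => r = 0 ∧ c < m + n) ?_ ?_).mono le_rfl
      fun M hM i hi => hM 0 i ⟨rfl, hi⟩
    · intro j hj t ht htj
      exact ⟨trivial, by simp [RExpr.eval, hf, joinVec, hj]⟩
    · intro j hj t ht htj
      exact ⟨trivial, by simp [RExpr.eval, hf, joinVec]⟩
    · intro i j
      rw [hs.mem 23 (by decide)]
      rfl
    · rintro r c ⟨rfl, hc⟩ hS
      exfalso
      by_cases h : c < m
      · exact hS (.inl ⟨c, h, rfl, by simp⟩)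
      · exact hS (.inr ⟨c - m, by omega, rfl, by omega⟩)
  -- The main term is `672 * (σ * (m + n) ^ 4)`, at most `672 * 16 = 10752` times `σ * max m n ^ 4`;
  -- storing the automaton and the register assignments fit into the rest of `20000`.
  · simp only [IExpr.cost]
    have hM : 1 ≤ max m n := hm.trans (le_max_left m n)
    have hmM := le_max_left m n
    have hnM := le_max_right m n
    generalize max m n = M at *
    have h1 : σ * (m + n) ^ 4 ≤ σ * (2 * M) ^ 4 := by gcongr; omega
    have h2 : σ * (m * m) ≤ σ * M ^ 4 := by
      gcongr
      calc m * m ≤ M * M := by gcongr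
        _ = M ^ 2 := by ring
        _ ≤ M ^ 4 := Nat.pow_le_pow_right hM (by norm_num)
    have h3 : σ * (n * n) ≤ σ * M ^ 4 := by
      gcongr
      calc n * n ≤ M * M := by gcongr
        _ = M ^ 2 := by ring
        _ ≤ M ^ 4 := Nat.pow_le_pow_right hM (by norm_num)
    have h4 : 1 * M ≤ σ * M ^ 4 := Nat.mul_le_mul hσ (Nat.le_self_pow (by norm_num) M)
    have h5 : σ * (2 * M) ^ 4 = 16 * (σ * M ^ 4) := by ring
    omega

end RealRAM

/-! ## Quantum random walks as weighted automata -/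

section Realification

open Finset

theorem sum_range_two_mul (k : ℕ) (g : ℕ → ℝ) :
    ∑ i ∈ range (2 * k), g i = ∑ e ∈ range k, (g (2 * e) + g (2 * e + 1)) := by
  induction k with
  | zero => simp
  | succ k ih => rw [Nat.mul_succ, sum_range_succ, sum_range_succ, ih, sum_range_succ]; ring

theorem sum_range_mul_div_mod (k D : ℕ) (g : ℕ → ℕ → ℝ) :
    ∑ n ∈ range (k * D), g (n / D) (n % D) = ∑ p ∈ range k, ∑ q ∈ range D, g p q := by
  induction k with
  | zero => simp
  | succ k ih =>
    rw [Nat.succ_mul, sum_range_add, ih, sum_range_succ]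
    congr 1
    refine sum_congr rfl fun q hq => ?_
    have hq := mem_range.mp hq
    rw [mul_comm, Nat.mul_add_div (by omega), Nat.mul_add_mod, Nat.div_eq_of_lt hq,
      Nat.mod_eq_of_lt hq, add_zero]

/-- The real coordinates of a complex vector, real and imaginary parts alternating. -/
def realVec (Re Im : ℕ → ℝ) (i : ℕ) : ℝ :=
  if i % 2 = 0 then Re (i / 2) else Im (i / 2)

/-- The real matrix of a complex matrix with respect to the coordinates of `realVec`. -/
def realMat (Re Im : ℕ → ℕ → ℝ) (i p : ℕ) : ℝ :=
  if i % 2 = 0 then if p % 2 = 0 then Re (i / 2) (p / 2) else -Im (i / 2) (p / 2)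
  else if p % 2 = 0 then Im (i / 2) (p / 2) else Re (i / 2) (p / 2)

theorem realVec_two_mul (Re Im : ℕ → ℝ) (e : ℕ) : realVec Re Im (2 * e) = Re e := by
  simp [realVec]

theorem realVec_two_mul_add_one (Re Im : ℕ → ℝ) (e : ℕ) : realVec Re Im (2 * e + 1) = Im e := by
  have : (2 * e + 1) / 2 = e := by omega
  simp [realVec, Nat.add_mod, this]

/-- A complex entry acts on real and imaginary parts as the `2 × 2` block with rows `(Re, -Im)` and
`(Im, Re)`; this is complex multiplication written out. -/
theorem sum_realMat_mul_realVec (k : ℕ) (Re Im : ℕ → ℕ → ℝ) (re im : ℕ → ℝ) (i : ℕ) :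
    ∑ p ∈ range (2 * k), realMat Re Im i p * realVec re im p =
      realVec (fun e => ∑ f ∈ range k, (Re e f * re f - Im e f * im f))
        (fun e => ∑ f ∈ range k, (Re e f * im f + Im e f * re f)) i := by
  rw [sum_range_two_mul, realVec]
  have h : ∀ f, (2 * f + 1) / 2 = f := fun f => by omega
  by_cases hi : i % 2 = 0
  · rw [if_pos hi]
    refine sum_congr rfl fun f _ => ?_
    rw [realVec_two_mul, realVec_two_mul_add_one]
    simp [realMat, hi, Nat.add_mod, h]
    ring
  · rw [if_neg hi]
    refine sum_congr rfl fun f _ => ?_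
    rw [realVec_two_mul, realVec_two_mul_add_one]
    simp [realMat, hi, Nat.add_mod, h]
    ring

/-! ### Tensor squares -/

/-- The tensor square of a vector with `D` entries. -/
def tensorSquare (D : ℕ) (x : ℕ → ℝ) (n : ℕ) : ℝ := x (n / D) * x (n % D)

/-- The trace as a functional on `D × D` matrices. -/
def traceVec (D n : ℕ) : ℝ := if n / D = n % D then 1 else 0

/-- The tensor square of the matrix that consists of the rows of `R` with numbers from `a * L` up
to `a * L + L - 1`, acting on row vectors from the right. -/
def tensorMat (D L : ℕ) (R : ℕ → ℕ → ℝ) (a n m : ℕ) : ℝ :=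
  if m / D / L = a ∧ m % D / L = a then R (m / D) (n / D) * R (m % D) (n % D) else 0

theorem sum_tensorSquare_mul_traceVec (D : ℕ) (x : ℕ → ℝ) :
    ∑ n ∈ range (D * D), tensorSquare D x n * traceVec D n = ∑ p ∈ range D, x p ^ 2 := by
  simp only [tensorSquare, traceVec]
  rw [sum_range_mul_div_mod D D fun p q => x p * x q * if p = q then 1 else 0]
  refine sum_congr rfl fun p hp => ?_
  simp only [mul_ite, mul_one, mul_zero, sum_ite_eq, hp, if_true]
  ring

/-- `(R x) ⊗ (R x)` is linear in `x ⊗ x`. Cutting both factors down to the block of `a` is the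
projection after the observation of `a`. -/
theorem sum_tensorSquare_mul_tensorMat (D L : ℕ) (R : ℕ → ℕ → ℝ) (x : ℕ → ℝ) (a m : ℕ) :
    ∑ n ∈ range (D * D), tensorSquare D x n * tensorMat D L R a n m =
      tensorSquare D (fun i => if i / L = a then ∑ p ∈ range D, R i p * x p else 0) m := by
  simp only [tensorSquare, tensorMat]
  by_cases h : m / D / L = a ∧ m % D / L = a
  · simp only [h, and_self, if_true]
    rw [sum_range_mul_div_mod D D fun p q => x p * x q * (R (m / D) p * R (m % D) q),
      sum_mul_sum]
    refine sum_congr rfl fun p _ => sum_congr rfl fun q _ => ?_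
    ring
  · simp only [h, if_false, mul_zero, sum_const_zero]
    rw [not_and_or] at h
    rcases h with h | h <;> simp [h]

end Realification

namespace QRW

open RealRAM Finset

variable {σ K : ℕ}

/-- The real coordinates of a wave function. -/
def realify (ψ : EuclideanSpace ℂ (Fin σ × Fin K)) : ℕ → ℝ :=
  realVec (vectorCells (fun i => (ψ (edge i)).re) 0) (vectorCells (fun i => (ψ (edge i)).im) 0)

/-- The real matrix of the evolution operator. -/
def realU (Q : QRW σ K) : ℕ → ℕ → ℝ :=
  realMat (matrixCells fun i j => (Q.U (edge i) (edge j)).re)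
    (matrixCells fun i j => (Q.U (edge i) (edge j)).im)

theorem sum_edge {M : Type*} [AddCommMonoid M] (g : Fin σ × Fin K → M) :
    ∑ e, g e = ∑ i : Fin (σ * K), g (edge i) :=
  (Equiv.sum_comp finProdFinEquiv.symm g).symm

theorem evolve_apply (Q : QRW σ K) (ψ : EuclideanSpace ℂ (Fin σ × Fin K)) (e : Fin σ × Fin K) :
    Q.evolve ψ e = ∑ f : Fin (σ * K), Q.U e (edge f) * ψ (edge f) := by
  rw [← sum_edge fun f => Q.U e f * ψ f]
  rfl

theorem sum_realU_mul_realify (Q : QRW σ K) (ψ : EuclideanSpace ℂ (Fin σ × Fin K)) {i : ℕ}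
    (hi : i < 2 * (σ * K)) :
    ∑ p ∈ range (2 * (σ * K)), Q.realU i p * realify ψ p = realify (Q.evolve ψ) i := by
  rw [realU, realify, sum_realMat_mul_realVec, realify]
  have hi2 : i / 2 < σ * K := by omega
  obtain ⟨e, he⟩ : ∃ e : Fin (σ * K), (e : ℕ) = i / 2 := ⟨⟨i / 2, hi2⟩, rfl⟩
  simp only [realVec, ← he, vectorCells_coe, Finset.sum_range, matrixCells_coe, evolve_apply]
  simp [Complex.mul_re, Complex.mul_im]

theorem edge_fst (e : Fin (σ * K)) : ((edge e).1 : ℕ) = e / K := rfl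

/-- Edge `(a, x)` has the number `a * K + x`, so the edges leaving `a` own the `2 * K` consecutive
real coordinates with quotient `a` modulo `2 * K`. -/
theorem realify_project (a : Fin σ) (φ : EuclideanSpace ℂ (Fin σ × Fin K)) {i : ℕ}
    (hi : i < 2 * (σ * K)) :
    realify (project a φ) i = if i / (2 * K) = a then realify φ i else 0 := by
  have hi2 : i / 2 < σ * K := by omega
  obtain ⟨e, he⟩ : ∃ e : Fin (σ * K), (e : ℕ) = i / 2 := ⟨⟨i / 2, hi2⟩, rfl⟩
  have hiff : (edge e).1 = a ↔ i / (2 * K) = a := by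
    rw [Fin.ext_iff, edge_fst, he, Nat.div_div_eq_div_mul]
  simp only [realify, realVec, ← he, vectorCells_coe, project, hiff]
  split_ifs <;> simp

theorem sum_realify_sq (ψ : EuclideanSpace ℂ (Fin σ × Fin K)) :
    ∑ i ∈ range (2 * (σ * K)), realify ψ i ^ 2 = ‖ψ‖ ^ 2 := by
  rw [sum_range_two_mul, EuclideanSpace.norm_sq_eq, sum_edge, Finset.sum_range]
  refine sum_congr rfl fun e _ => ?_
  rw [realify, realVec_two_mul, realVec_two_mul_add_one, vectorCells_coe, vectorCells_coe,
    Complex.sq_norm, Complex.normSq_apply]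
  ring

/-! ### Word probabilities without renormalization -/

/-- The squared norm of the wave function after the observation of a word, without any
renormalization. -/
noncomputable def sqNormAfter (Q : QRW σ K) :
    EuclideanSpace ℂ (Fin σ × Fin K) → List (Fin σ) → ℝ
  | ψ, [] => ‖ψ‖ ^ 2
  | ψ, a :: w => Q.sqNormAfter (project a (Q.evolve ψ)) w

theorem sqNormAfter_smul (Q : QRW σ K) (c : ℂ) (ψ : EuclideanSpace ℂ (Fin σ × Fin K))
    (w : List (Fin σ)) : Q.sqNormAfter (c • ψ) w = ‖c‖ ^ 2 * Q.sqNormAfter ψ w := by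
  induction w generalizing ψ with
  | nil => simp [sqNormAfter, norm_smul, mul_pow]
  | cons a w ih =>
    simp only [sqNormAfter]
    rw [← ih]
    congr 1
    ext e
    simp only [project, evolve, WithLp.ofLp_smul, Matrix.mulVec_smul, PiLp.smul_apply,
      Pi.smul_apply, smul_ite, smul_zero]

theorem sum_norm_sq_eq (a : Fin σ) (φ : EuclideanSpace ℂ (Fin σ × Fin K)) :
    ∑ x, ‖φ (a, x)‖ ^ 2 = ‖project a φ‖ ^ 2 := by
  rw [EuclideanSpace.norm_sq_eq, Fintype.sum_prod_type, Finset.sum_eq_single a]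
  · simp [project]
  · intro b _ hb
    simp [project, hb]
  · simp

/-- The probability of the observed letter is the squared norm of the projection, which is exactly
the factor removed by normalizing it. -/
theorem probFrom_eq_sqNormAfter (Q : QRW σ K) {ψ : EuclideanSpace ℂ (Fin σ × Fin K)}
    (hψ : ‖ψ‖ = 1) (w : List (Fin σ)) : Q.probFrom ψ w = Q.sqNormAfter ψ w := by
  induction w generalizing ψ with
  | nil => simp [probFrom, sqNormAfter, hψ]
  | cons a w ih =>
    rw [probFrom, sqNormAfter, sum_norm_sq_eq]
    -- For a letter of probability zero the collapsed function is `0`, not a unit vector, and the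
    -- induction hypothesis does not apply; but then both sides vanish.
    by_cases h : project a (Q.evolve ψ) = 0
    · have h0 : Q.sqNormAfter 0 w = 0 := by simpa using Q.sqNormAfter_smul 0 0 w
      rw [h, h0, norm_zero, zero_pow two_ne_zero, zero_mul]
    · have hn : ‖project a (Q.evolve ψ)‖ ≠ 0 := norm_ne_zero_iff.mpr h
      rw [ih, collapse, sqNormAfter_smul]
      · simp only [Complex.norm_real, norm_inv, norm_norm]
        field_simp
      · rw [collapse, norm_smul]
        simp only [Complex.norm_real, norm_inv, norm_norm]
        field_simp

/-- Reading `a` turns the tensor square of `ψ` into that of its evolved and projected image. The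
equality is checked only for indices below `D²`, the only ones that `weight` sees. -/
theorem weight_tensorSquare (Q : QRW σ K) (ψ : EuclideanSpace ℂ (Fin σ × Fin K))
    (w : List (Fin σ)) :
    weight (2 * (σ * K) * (2 * (σ * K))) (tensorMat (2 * (σ * K)) (2 * K) Q.realU)
      (traceVec (2 * (σ * K))) (tensorSquare (2 * (σ * K)) (realify ψ)) w =
      Q.sqNormAfter ψ w := by
  induction w generalizing ψ with
  | nil => rw [weight, sum_tensorSquare_mul_traceVec, sum_realify_sq, sqNormAfter]
  | cons a w ih =>
    rw [weight, sqNormAfter, ← ih]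
    refine weight_congr _ _ _ (fun m hm => ?_) w
    rw [sum_tensorSquare_mul_tensorMat, tensorSquare, tensorSquare]
    have h1 : m / (2 * (σ * K)) < 2 * (σ * K) := Nat.div_lt_of_lt_mul hm
    have h2 : m % (2 * (σ * K)) < 2 * (σ * K) := Nat.mod_lt _ (Nat.pos_of_ne_zero fun h => by
      simp [h] at hm)
    simp only [realify_project _ _ h1, realify_project _ _ h2, sum_realU_mul_realify _ _ h1,
      sum_realU_mul_realify _ _ h2]

theorem weight_eq_prob (Q : QRW σ K) (w : List (Fin σ)) :
    weight (2 * (σ * K) * (2 * (σ * K))) (tensorMat (2 * (σ * K)) (2 * K) Q.realU)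
      (traceVec (2 * (σ * K))) (tensorSquare (2 * (σ * K)) (realify Q.ψ₀)) w = Q.prob w := by
  rw [weight_tensorSquare, prob, probFrom_eq_sqNormAfter Q Q.norm_ψ₀]

theorem card_edges_pos (Q : QRW σ K) : 1 ≤ σ * K := by
  by_contra h
  have h0 : σ * K = 0 := by omega
  have : IsEmpty (Fin σ × Fin K) := by
    rw [← Fintype.card_eq_zero_iff]
    simpa using h0
  have hψ := Q.norm_ψ₀
  rw [Subsingleton.elim Q.ψ₀ 0, norm_zero] at hψ
  exact zero_ne_one hψ

/-- Splitting a complex matrix into its self-adjoint real and imaginary parts is injective, so `2 *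
k² ≤ 2 * dim` for `k = σ * K`. This direction suffices, because the dimension enters only the cost
bound. -/
theorem sq_le_stateSpaceDim (σ K : ℕ) : (σ * K) ^ 2 ≤ stateSpaceDim σ K := by
  let E := Matrix (Fin σ × Fin K) (Fin σ × Fin K) ℂ
  let g : E →ₗ[ℝ] selfAdjoint E × selfAdjoint E := realPart.prod imaginaryPart
  have hg : Function.Injective g := by
    intro x y hxy
    have h1 : realPart x = realPart y := congrArg Prod.fst hxy
    have h2 : imaginaryPart x = imaginaryPart y := congrArg Prod.snd hxy
    rw [← realPart_add_I_smul_imaginaryPart x, h1, h2, realPart_add_I_smul_imaginaryPart]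
  have hfin : Module.Finite ℝ (selfAdjoint E) :=
    Module.Finite.of_injective (selfAdjoint.submodule ℝ E).subtype Subtype.val_injective
  have h := LinearMap.finrank_le_finrank_of_injective hg
  have hE : Module.finrank ℝ E = 2 * (σ * K) ^ 2 := by
    rw [← Module.finrank_mul_finrank ℝ ℂ E, Complex.finrank_real_complex,
      Module.finrank_matrix]
    simp
    ring
  rw [Module.finrank_prod, hE] at h
  change (σ * K) ^ 2 ≤ Module.finrank ℝ (selfAdjoint E)
  omega

end QRW

/-! ## The program for quantum random walks

The registers `5`, `7`, `17` hold `L = 2 * K`, `D = σ * L` and the number of edges of the first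
walk, the registers `6`, `8`, `18` those of the second one; the registers `16` and `9` hold the
positions `0` and `D * D` where the states of the two walks begin. The real forms of the evolution
operators go to the arrays `30` and `31`, those of the initial wave functions to `32` and `33`. -/

namespace RealRAM

open Program

/-- Store the real matrix of one of the evolution operators. -/
def realMatProg (o : Bool) : Program :=
  loopLt 10 (cond o 18 17) (loopLt 11 (cond o 18 17)
    (.seq (.seq
      (.setCell (cond o 31 30) (.mul (.const 2) (.reg 10)) (.mul (.const 2) (.reg 11))
        (.cell (cond o 4 0) (.reg 10) (.reg 11)))
      (.setCell (cond o 31 30) (.mul (.const 2) (.reg 10))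
        (.add (.mul (.const 2) (.reg 11)) (.const 1))
        (.sub (.const 0) (.cell (cond o 5 1) (.reg 10) (.reg 11)))))
      (.seq
      (.setCell (cond o 31 30) (.add (.mul (.const 2) (.reg 10)) (.const 1))
        (.mul (.const 2) (.reg 11))
        (.cell (cond o 5 1) (.reg 10) (.reg 11)))
      (.setCell (cond o 31 30) (.add (.mul (.const 2) (.reg 10)) (.const 1))
        (.add (.mul (.const 2) (.reg 11)) (.const 1))
        (.cell (cond o 4 0) (.reg 10) (.reg 11))))))

theorem realMatProg_runs {o : Bool} {s : State} {k : ℕ} (hk : s.idx (cond o 18 17) = k)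
    (hk1 : 1 ≤ k) :
    Runs (realMatProg o) s (124 * (k * k)) fun m => ∀ i < 2 * k, ∀ p < 2 * k,
      m (cond o 31 30) i p = realMat (s.mem (cond o 4 0)) (s.mem (cond o 5 1)) i p := by
  have hfill : Fills (realMatProg o) s (124 * (k * k)) (cond o 31 30)
      (realMat (s.mem (cond o 4 0)) (s.mem (cond o 5 1)))
      (fun i p => ∃ e < k, ∃ f < k, (i = 2 * e ∨ i = 2 * e + 1) ∧ (p = 2 * f ∨ p = 2 * f + 1)) := by
    refine (Fills.forLt (C := 112) (m := k) hk (by cases o <;> decide) (by cases o <;> decide)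
      (by cases o <;> decide) hk1 hk1 fun e he s₁ hs₁ hx₁ => ?_)
    refine (Fills.forLt (C := 100) (m := 1) (n := k) ((hs₁.idx _ (by cases o <;> decide)).trans hk)
      (by cases o <;> decide) (by cases o <;> decide) (by cases o <;> decide) hk1 le_rfl
      fun f hf s₂ hs₂ hx₂ => ?_).mono (by simp) fun _ _ => id
    have key : ∀ t : State, t.idx 10 = s₂.idx 10 → t.idx 11 = s₂.idx 11 →
        t.mem (cond o 4 0) = s₂.mem (cond o 4 0) → t.mem (cond o 5 1) = s₂.mem (cond o 5 1) →
        t.idx 10 = e ∧ t.idx 11 = f ∧ t.mem (cond o 4 0) = s.mem (cond o 4 0) ∧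
        t.mem (cond o 5 1) = s.mem (cond o 5 1) := by
      intro t h1 h2 h3 h4
      refine ⟨?_, ?_, ?_, ?_⟩
      · rw [h1, hs₂.idx _ (by cases o <;> decide), hx₁]
      · rw [h2, hx₂]
      · rw [h3, hs₂.mem _ (by cases o <;> decide), hs₁.mem _ (by cases o <;> decide)]
      · rw [h4, hs₂.mem _ (by cases o <;> decide), hs₁.mem _ (by cases o <;> decide)]
    have hd : ∀ f : ℕ, (2 * f + 1) / 2 = f := fun f => by omega
    refine (Fills.seq (c₁ := 50) (c₂ := 50) (S₁ := fun i p => i = 2 * e ∧ (p = 2 * f ∨ p = 2 * f + 1))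
      (S₂ := fun i p => i = 2 * e + 1 ∧ (p = 2 * f ∨ p = 2 * f + 1)) ?_ fun t ht => ?_).mono le_rfl
      fun i p => by omega
    · refine (Fills.seq (c₁ := 25) (c₂ := 25) (S₁ := fun i p => i = 2 * e ∧ p = 2 * f)
        (S₂ := fun i p => i = 2 * e ∧ p = 2 * f + 1) ?_ fun t ht => ?_).mono le_rfl
        fun i p => by omega
      · obtain ⟨h1, h2, h3, h4⟩ := key s₂ rfl rfl rfl rfl
        refine (Fills.setCell (by simp [RExpr.cost, IExpr.cost]) (by exact trivial) ?_).mono le_rfl ?_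
        · simp [RExpr.eval, IExpr.eval, h1, h2, h3, realMat]
        · simp [IExpr.eval, h1, h2]
      · obtain ⟨h1, h2, h3, h4⟩ := key t (ht.idx _ (by cases o <;> decide))
          (ht.idx _ (by cases o <;> decide)) (ht.mem _ (by cases o <;> decide))
          (ht.mem _ (by cases o <;> decide))
        refine (Fills.setCell (by simp [RExpr.cost, IExpr.cost]) (by exact ⟨trivial, trivial⟩)
          ?_).mono le_rfl ?_
        · simp [RExpr.eval, IExpr.eval, h1, h2, h4, realMat, Nat.add_mod, hd]
        · simp [IExpr.eval, h1, h2]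
    · refine (Fills.seq (c₁ := 25) (c₂ := 25) (S₁ := fun i p => i = 2 * e + 1 ∧ p = 2 * f)
        (S₂ := fun i p => i = 2 * e + 1 ∧ p = 2 * f + 1) ?_ fun t' ht' => ?_).mono le_rfl
        fun i p => by omega
      · obtain ⟨h1, h2, h3, h4⟩ := key t (ht.idx _ (by cases o <;> decide))
          (ht.idx _ (by cases o <;> decide)) (ht.mem _ (by cases o <;> decide))
          (ht.mem _ (by cases o <;> decide))
        refine (Fills.setCell (by simp [RExpr.cost, IExpr.cost]) (by exact trivial) ?_).mono le_rfl ?_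
        · simp [RExpr.eval, IExpr.eval, h1, h2, h4, realMat, Nat.add_mod, hd]
        · simp [IExpr.eval, h1, h2]
      · obtain ⟨h1, h2, h3, h4⟩ := key t'
          ((ht'.idx _ (by cases o <;> decide)).trans (ht.idx _ (by cases o <;> decide)))
          ((ht'.idx _ (by cases o <;> decide)).trans (ht.idx _ (by cases o <;> decide)))
          ((ht'.mem _ (by cases o <;> decide)).trans (ht.mem _ (by cases o <;> decide)))
          ((ht'.mem _ (by cases o <;> decide)).trans (ht.mem _ (by cases o <;> decide)))
        refine (Fills.setCell (by simp [RExpr.cost, IExpr.cost]) (by exact trivial) ?_).mono le_rfl ?_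
        · simp [RExpr.eval, IExpr.eval, h1, h2, h3, realMat, Nat.add_mod, hd]
        · simp [IExpr.eval, h1, h2]
  refine Runs.mono hfill le_rfl fun m hm i hi p hp => hm.2 i p ?_
  exact ⟨i / 2, by omega, p / 2, by omega, by omega, by omega⟩

/-- Store the real coordinates of one of the initial wave functions. -/
def realVecProg (o : Bool) : Program :=
  loopLt 10 (cond o 18 17)
    (.seq
      (.setCell (cond o 33 32) (.const 0) (.mul (.const 2) (.reg 10))
        (.cell (cond o 6 2) (.const 0) (.reg 10)))
      (.setCell (cond o 33 32) (.const 0) (.add (.mul (.const 2) (.reg 10)) (.const 1))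
        (.cell (cond o 7 3) (.const 0) (.reg 10))))

theorem realVecProg_runs {o : Bool} {s : State} {k : ℕ} (hk : s.idx (cond o 18 17) = k)
    (hk1 : 1 ≤ k) :
    Runs (realVecProg o) s (62 * k) fun m => ∀ i < 2 * k,
      m (cond o 33 32) 0 i = realVec (s.mem (cond o 6 2) 0) (s.mem (cond o 7 3) 0) i := by
  have hfill : Fills (realVecProg o) s (62 * k) (cond o 33 32)
      (fun _ => realVec (s.mem (cond o 6 2) 0) (s.mem (cond o 7 3) 0))
      (fun i p => ∃ f < k, i = 0 ∧ (p = 2 * f ∨ p = 2 * f + 1)) := by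
    refine (Fills.forLt (C := 50) (m := 1) hk (by cases o <;> decide) (by cases o <;> decide)
      (by cases o <;> decide) hk1 le_rfl fun f hf s₁ hs₁ hx₁ => ?_).mono (by simp) fun _ _ => id
    refine (Fills.seq (c₁ := 25) (c₂ := 25) (S₁ := fun i p => i = 0 ∧ p = 2 * f)
      (S₂ := fun i p => i = 0 ∧ p = 2 * f + 1) ?_ fun t ht => ?_).mono le_rfl
      fun i p => by omega
    · refine (Fills.setCell (by simp [RExpr.cost, IExpr.cost]) (by exact trivial) ?_).mono le_rfl ?_
      · simp only [RExpr.eval, IExpr.eval, hx₁, realVec_two_mul]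
        rw [hs₁.mem _ (by cases o <;> decide)]
      · simp [IExpr.eval, hx₁]
    · have h1 : t.idx 10 = f := (ht.idx _ (by cases o <;> decide)).trans hx₁
      refine (Fills.setCell (by simp [RExpr.cost, IExpr.cost]) (by exact trivial) ?_).mono le_rfl ?_
      · simp only [RExpr.eval, IExpr.eval, h1, realVec_two_mul_add_one]
        rw [ht.mem _ (by cases o <;> decide), hs₁.mem _ (by cases o <;> decide)]
      · simp [IExpr.eval, h1]
  refine Runs.mono hfill le_rfl fun m hm i hi => hm.2 0 i ?_
  exact ⟨i / 2, by omega, rfl, by omega⟩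

/-- Store the tensor squares of the blocks of one of the evolution operators. -/
def tensorMatProg (o : Bool) : Program :=
  loopLt 10 0 (loopLt 11 (cond o 6 5) (loopLt 12 (cond o 6 5) (loopLt 13 (cond o 8 7)
    (loopLt 14 (cond o 8 7)
      (.setCell 20
        (.add (.mul (.reg 10) (.reg 3))
          (.add (.reg (cond o 9 16)) (.add (.mul (.reg 13) (.reg (cond o 8 7))) (.reg 14))))
        (.add (.reg (cond o 9 16))
          (.add (.mul (.add (.mul (.reg 10) (.reg (cond o 6 5))) (.reg 11)) (.reg (cond o 8 7)))
            (.add (.mul (.reg 10) (.reg (cond o 6 5))) (.reg 12))))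
        (.mul
          (.cell (cond o 31 30) (.add (.mul (.reg 10) (.reg (cond o 6 5))) (.reg 11)) (.reg 13))
          (.cell (cond o 31 30) (.add (.mul (.reg 10) (.reg (cond o 6 5))) (.reg 12))
            (.reg 14))))))))

/-- Per letter only the `L²` columns belonging to pairs of coordinates in its block are written. The
constant is 100 for the innermost assignment and 12 for each of five loops. -/
theorem tensorMatProg_fills {o : Bool} {s : State} {σ L D N k : ℕ} {Φ : ℕ → ℕ → ℝ}
    (h0 : s.idx 0 = σ) (h3 : s.idx 3 = N) (hL : s.idx (cond o 6 5) = L)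
    (hD : s.idx (cond o 8 7) = D) (hk : s.idx (cond o 9 16) = k)
    (hσ : 1 ≤ σ) (hL1 : 1 ≤ L) (hD1 : 1 ≤ D)
    (hΦ : ∀ a < σ, ∀ y < L, ∀ z < L, ∀ p < D, ∀ q < D,
      s.mem (cond o 31 30) (a * L + y) p * s.mem (cond o 31 30) (a * L + z) q =
        Φ (a * N + (k + (p * D + q))) (k + ((a * L + y) * D + (a * L + z)))) :
    Fills (tensorMatProg o) s (160 * (σ * (L * (L * (D * D))))) 20 Φ fun r c =>
      ∃ a < σ, ∃ y < L, ∃ z < L, ∃ p < D, ∃ q < D,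
        r = a * N + (k + (p * D + q)) ∧ c = k + ((a * L + y) * D + (a * L + z)) := by
  have hDD : 1 ≤ D * D := Nat.mul_pos hD1 hD1
  have hLDD : 1 ≤ L * (D * D) := Nat.mul_pos hL1 hDD
  refine Fills.forLt (C := 148) (m := L * (L * (D * D))) h0 (by decide) (by cases o <;> decide)
    (by cases o <;> decide) hσ (Nat.mul_pos hL1 hLDD) fun a ha s₁ hs₁ hx₁ => ?_
  refine Fills.forLt (C := 136) (m := L * (D * D)) (n := L)
    ((hs₁.idx _ (by cases o <;> decide)).trans hL)
    (by cases o <;> decide) (by cases o <;> decide) (by cases o <;> decide) hL1 hLDD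
    fun y hy s₂ hs₂ hx₂ => ?_
  have hs₂' : (tensorMatProg o).Same s s₂ :=
    hs₁.trans (hs₂.of_imp (by simp +contextual [loopLt, keepsIdx])
      (by simp +contextual [loopLt, keepsMem]))
  refine Fills.forLt (C := 124) (m := D * D) (n := L)
    ((hs₂'.idx _ (by cases o <;> decide)).trans hL)
    (by cases o <;> decide) (by cases o <;> decide) (by cases o <;> decide) hL1 hDD
    fun z hz s₃ hs₃ hx₃ => ?_
  have hs₃' : (tensorMatProg o).Same s s₃ :=
    hs₂'.trans (hs₃.of_imp (by simp +contextual [tensorMatProg, loopLt, keepsIdx])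
      (by simp +contextual [tensorMatProg, loopLt, keepsMem]))
  refine Fills.forLt (C := 112) (m := D) (n := D)
    ((hs₃'.idx _ (by cases o <;> decide)).trans hD)
    (by cases o <;> decide) (by cases o <;> decide) (by cases o <;> decide) hD1 hD1
    fun p hp s₄ hs₄ hx₄ => ?_
  have hs₄' : (tensorMatProg o).Same s s₄ :=
    hs₃'.trans (hs₄.of_imp (by simp +contextual [tensorMatProg, loopLt, keepsIdx])
      (by simp +contextual [tensorMatProg, loopLt, keepsMem]))
  refine (Fills.forLt (C := 100) (m := 1) (n := D)
    ((hs₄'.idx _ (by cases o <;> decide)).trans hD)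
    (by cases o <;> decide) (by cases o <;> decide) (by cases o <;> decide) hD1 le_rfl
    fun q hq s₅ hs₅ hx₅ => ?_).mono (by simp) fun _ _ => id
  have hs₅' : (tensorMatProg o).Same s s₅ :=
    hs₄'.trans (hs₅.of_imp (by simp +contextual [tensorMatProg, loopLt, keepsIdx])
      (by simp +contextual [tensorMatProg, loopLt, keepsMem]))
  have h13 : s₅.idx 13 = p := by rw [hs₅.idx _ (by cases o <;> decide), hx₄]
  have h12 : s₅.idx 12 = z := by
    rw [hs₅.idx _ (by cases o <;> decide), hs₄.idx _ (by cases o <;> decide), hx₃]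
  have h11 : s₅.idx 11 = y := by
    rw [hs₅.idx _ (by cases o <;> decide), hs₄.idx _ (by cases o <;> decide),
      hs₃.idx _ (by cases o <;> decide), hx₂]
  have h10 : s₅.idx 10 = a := by
    rw [hs₅.idx _ (by cases o <;> decide), hs₄.idx _ (by cases o <;> decide),
      hs₃.idx _ (by cases o <;> decide), hs₂.idx _ (by cases o <;> decide), hx₁]
  have h3' : s₅.idx 3 = N := (hs₅'.idx _ (by cases o <;> decide)).trans h3
  have hL' : s₅.idx (cond o 6 5) = L := (hs₅'.idx _ (by cases o <;> decide)).trans hL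
  have hD' : s₅.idx (cond o 8 7) = D := (hs₅'.idx _ (by cases o <;> decide)).trans hD
  have hk' : s₅.idx (cond o 9 16) = k := (hs₅'.idx _ (by cases o <;> decide)).trans hk
  have hR : s₅.mem (cond o 31 30) = s.mem (cond o 31 30) := hs₅'.mem _ (by cases o <;> decide)
  refine (Fills.setCell (by simp [RExpr.cost, IExpr.cost]) (by exact ⟨trivial, trivial⟩) ?_).mono
    le_rfl ?_
  · simp only [RExpr.eval, IExpr.eval, h10, h11, h12, h13, hx₅, h3', hL', hD', hk', hR]
    exact hΦ a ha y hy z hz p hp q hq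
  · simp only [IExpr.eval, h10, h11, h12, h13, hx₅, h3', hL', hD', hk']
    exact fun _ _ => id

/-- Store the tensor square of one of the initial wave functions. -/
def tensorSquareProg (o : Bool) : Program :=
  loopLt 10 (cond o 8 7) (loopLt 11 (cond o 8 7)
    (.setCell 22 (.const 0)
      (.add (.reg (cond o 9 16)) (.add (.mul (.reg 10) (.reg (cond o 8 7))) (.reg 11)))
      (.mul (.cell (cond o 33 32) (.const 0) (.reg 10))
        (.cell (cond o 33 32) (.const 0) (.reg 11)))))

theorem tensorSquareProg_fills {o : Bool} {s : State} {D k : ℕ} {Φ : ℕ → ℕ → ℝ}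
    (hD : s.idx (cond o 8 7) = D) (hk : s.idx (cond o 9 16) = k) (hD1 : 1 ≤ D)
    (hΦ : ∀ p < D, ∀ q < D,
      s.mem (cond o 33 32) 0 p * s.mem (cond o 33 32) 0 q = Φ 0 (k + (p * D + q))) :
    Fills (tensorSquareProg o) s (54 * (D * D)) 22 Φ fun r c =>
      ∃ p < D, ∃ q < D, r = 0 ∧ c = k + (p * D + q) := by
  refine Fills.forLt (C := 42) (m := D) hD (by cases o <;> decide) (by cases o <;> decide)
    (by cases o <;> decide) hD1 hD1 fun p hp s₁ hs₁ hx₁ => ?_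
  refine (Fills.forLt (C := 30) (m := 1) (n := D)
    ((hs₁.idx _ (by cases o <;> decide)).trans hD)
    (by cases o <;> decide) (by cases o <;> decide) (by cases o <;> decide) hD1 le_rfl
    fun q hq s₂ hs₂ hx₂ => ?_).mono (by simp) fun _ _ => id
  have h10 : s₂.idx 10 = p := by rw [hs₂.idx _ (by cases o <;> decide), hx₁]
  have hD' : s₂.idx (cond o 8 7) = D := by
    rw [hs₂.idx _ (by cases o <;> decide), hs₁.idx _ (by cases o <;> decide), hD]
  have hk' : s₂.idx (cond o 9 16) = k := by
    rw [hs₂.idx _ (by cases o <;> decide), hs₁.idx _ (by cases o <;> decide), hk]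
  have hR : s₂.mem (cond o 33 32) = s.mem (cond o 33 32) := by
    rw [hs₂.mem _ (by cases o <;> decide), hs₁.mem _ (by cases o <;> decide)]
  refine (Fills.setCell (by simp [RExpr.cost, IExpr.cost]) (by exact ⟨trivial, trivial⟩) ?_).mono
    le_rfl ?_
  · simp only [RExpr.eval, IExpr.eval, h10, hx₂, hD', hk', hR]
    exact hΦ p hp q hq
  · simp only [IExpr.eval, h10, hx₂, hD', hk']
    exact fun _ _ => id

/-- Store the trace functional, with a sign. -/
def traceVecProg (o : Bool) : Program :=
  loopLt 10 (cond o 8 7)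
    (.setCell 23 (.const 0)
      (.add (.reg (cond o 9 16)) (.add (.mul (.reg 10) (.reg (cond o 8 7))) (.reg 10)))
      (.const (cond o (-1) 1)))

theorem traceVecProg_fills {o : Bool} {s : State} {D k : ℕ} {Φ : ℕ → ℕ → ℝ}
    (hD : s.idx (cond o 8 7) = D) (hk : s.idx (cond o 9 16) = k) (hD1 : 1 ≤ D)
    (hΦ : ∀ p < D, ((cond o (-1) 1 : ℚ) : ℝ) = Φ 0 (k + (p * D + p))) :
    Fills (traceVecProg o) s (42 * D) 23 Φ fun r c =>
      ∃ p < D, r = 0 ∧ c = k + (p * D + p) := by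
  refine (Fills.forLt (C := 30) (m := 1) hD (by cases o <;> decide) (by cases o <;> rfl)
    (by cases o <;> rfl) hD1 le_rfl fun p hp s₁ hs₁ hx₁ => ?_).mono (by simp) fun _ _ => id
  have hD' : s₁.idx (cond o 8 7) = D := by rw [hs₁.idx _ (by cases o <;> rfl), hD]
  have hk' : s₁.idx (cond o 9 16) = k := by rw [hs₁.idx _ (by cases o <;> rfl), hk]
  refine (Fills.setCell (by simp [RExpr.cost, IExpr.cost]) (by exact trivial) ?_).mono
    le_rfl ?_
  · simp only [RExpr.eval, IExpr.eval, hx₁, hD', hk']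
    exact hΦ p hp
  · simp only [IExpr.eval, hx₁, hD', hk']
    exact fun _ _ => id

theorem mul_add_div_mod {D p q : ℕ} (hq : q < D) : (p * D + q) / D = p ∧ (p * D + q) % D = q := by
  rw [mul_comm, Nat.mul_add_div (by omega), Nat.mul_add_mod, Nat.div_eq_of_lt hq,
    Nat.mod_eq_of_lt hq]
  simp

theorem mul_add_lt_mul {k D p q : ℕ} (hp : p < k) (hq : q < D) : p * D + q < k * D := by
  calc p * D + q < p * D + D := by omega
    _ = (p + 1) * D := by ring
    _ ≤ k * D := Nat.mul_le_mul_right _ hp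

theorem tensorMat_apply {D L a y z p q : ℕ} {R : ℕ → ℕ → ℝ} (hy : y < L) (hz : z < L)
    (hzD : a * L + z < D) (hq : q < D) :
    tensorMat D L R a (p * D + q) ((a * L + y) * D + (a * L + z)) =
      R (a * L + y) p * R (a * L + z) q := by
  rw [tensorMat, (mul_add_div_mod hzD).1, (mul_add_div_mod hzD).2, (mul_add_div_mod hq).1,
    (mul_add_div_mod hq).2, (mul_add_div_mod hy).1, (mul_add_div_mod hz).1]
  simp

/-- Read contrapositively: the entries that `tensorMatProg` leaves out are zero. -/
theorem exists_of_tensorMat_ne_zero {D L a n m : ℕ} {R : ℕ → ℕ → ℝ} (hL : 1 ≤ L)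
    (hn : n < D * D) (h : tensorMat D L R a n m ≠ 0) :
    ∃ y < L, ∃ z < L, ∃ p < D, ∃ q < D,
      n = p * D + q ∧ m = (a * L + y) * D + (a * L + z) := by
  have hD : 0 < D := Nat.pos_of_ne_zero fun h => by simp [h] at hn
  rw [tensorMat] at h
  split_ifs at h with hc
  · refine ⟨m / D % L, Nat.mod_lt _ hL, m % D % L, Nat.mod_lt _ hL, n / D,
      Nat.div_lt_of_lt_mul hn, n % D, Nat.mod_lt _ hD, ?_, ?_⟩
    · rw [Nat.div_add_mod']
    · obtain ⟨h1, h2⟩ := hc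
      have h3 : a * L + m / D % L = m / D := by rw [← h1, Nat.div_add_mod']
      have h4 : a * L + m % D % L = m % D := by rw [← h2, Nat.div_add_mod']
      rw [h3, h4, Nat.div_add_mod']
  · exact absurd rfl h

end RealRAM

/-! ### The complete test for quantum random walks -/

namespace RealRAM

open Program

/-- Store the weighted automaton for two quantum random walks, and test it. -/
def qrwLoadTestProg : Program :=
  .seq (.seq (tensorMatProg false) (tensorMatProg true))
    (.seq (.seq (tensorSquareProg false) (tensorSquareProg true))
      (.seq (.seq (traceVecProg false) (traceVecProg true)) zeroTestProg))

/-- `K` and `L` stand for the block sizes in real coordinates, later twice the numbers of edges per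
vertex. The real data are arbitrary: neither unitarity nor norms play a role in the comparison. -/
theorem qrwLoadTestProg_runs {s : State} {σ K L D E N : ℕ} {R S : ℕ → ℕ → ℝ} {x y : ℕ → ℝ}
    (h0 : s.idx 0 = σ) (h3 : s.idx 3 = N) (h4 : s.idx 4 = N + 1) (h5 : s.idx 5 = K)
    (h6 : s.idx 6 = L) (h7 : s.idx 7 = D) (h8 : s.idx 8 = E) (h9 : s.idx 9 = D * D)
    (h16 : s.idx 16 = 0) (hσ : 1 ≤ σ) (hK : 1 ≤ K) (hL : 1 ≤ L) (hD : σ * K = D)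
    (hE : σ * L = E) (hN : D * D + E * E = N)
    (hmem : ∀ A ∈ [20, 21, 22, 23, 24], ∀ i j, s.mem A i j = 0)
    (hR : ∀ i < D, ∀ p < D, s.mem 30 i p = R i p) (hS : ∀ i < E, ∀ p < E, s.mem 31 i p = S i p)
    (hx : ∀ i < D, s.mem 32 0 i = x i) (hy : ∀ i < E, s.mem 33 0 i = y i) :
    Runs qrwLoadTestProg s
      (160 * (σ * (K * (K * (D * D)))) + 160 * (σ * (L * (L * (E * E)))) +
        (54 * (D * D) + 54 * (E * E) + (42 * D + 42 * E + 672 * (σ * N ^ 4))))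
      fun m => m 24 0 0 = 0 ↔ ∀ w : List (Fin σ),
        weight (D * D) (tensorMat D K R) (traceVec D) (tensorSquare D x) w =
        weight (E * E) (tensorMat E L S) (traceVec E) (tensorSquare E y) w := by
  have hD1 : 1 ≤ D := hD ▸ Nat.mul_pos hσ hK
  have hE1 : 1 ≤ E := hE ▸ Nat.mul_pos hσ hL
  have hDD : 1 ≤ D * D := Nat.mul_pos hD1 hD1
  set A : ℕ → ℕ → ℕ → ℝ := fun a => blockSum (D * D) (tensorMat D K R a) (tensorMat E L S a)
    with hA
  set v := joinVec (D * D) (tensorSquare D x) (tensorSquare E y) with hv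
  set f := joinVec (D * D) (traceVec D) (fun n => -traceVec E n) with hf
  have hiff : ∀ w : List (Fin σ),
      weight (D * D) (tensorMat D K R) (traceVec D) (tensorSquare D x) w =
        weight (E * E) (tensorMat E L S) (traceVec E) (tensorSquare E y) w ↔
      weight N A f v w = 0 := by
    intro w
    rw [← hN, hA, hf, hv, weight_blockSum, weight_neg, ← sub_eq_add_neg, sub_eq_zero]
  simp only [hiff]
  refine Runs.load_zeroTest ?_ ?_ ?_ (by decide) (by decide) (by decide) (by decide)
    h0 h3 h4 hσ (by omega) (hmem 21 (by simp)) (hmem 24 (by simp) 0 0)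
  · refine ((Fills.seq (tensorMatProg_fills (o := false)
      (Φ := stackedBlocks N (D * D) (tensorMat D K R) (tensorMat E L S))
      h0 h3 h5 h7 h16 hσ hK hD1 ?_)
      fun s' hs' => tensorMatProg_fills (o := true)
        ((hs'.idx 0 (by decide)).trans h0) ((hs'.idx 3 (by decide)).trans h3)
        ((hs'.idx 6 (by decide)).trans h6) ((hs'.idx 8 (by decide)).trans h8)
        ((hs'.idx 9 (by decide)).trans h9) hσ hL hE1 ?_).runs_of_zero
      (D := fun r c => ∃ a < σ, ∃ i < N, ∃ j < N, r = a * N + i ∧ c = j)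
      (hmem 20 (by simp)) ?_).mono le_rfl ?_
    · intro a ha i hi j hj p hp q hq
      have hai : a * K + i < D := hD ▸ mul_add_lt_mul ha hi
      have haj : a * K + j < D := hD ▸ mul_add_lt_mul ha hj
      have h1 := mul_add_lt_mul hp hq
      have h2 := mul_add_lt_mul hai haj
      rw [stackedBlocks_apply (by omega)]
      simp only [blockSum, zero_add, h1, h2, if_true, cond_false]
      rw [tensorMat_apply hi hj haj hq, hR _ hai _ hp, hR _ haj _ hq]
    · intro a ha i hi j hj p hp q hq
      have hai : a * L + i < E := hE ▸ mul_add_lt_mul ha hi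
      have haj : a * L + j < E := hE ▸ mul_add_lt_mul ha hj
      have h1 := mul_add_lt_mul hp hq
      rw [stackedBlocks_apply (by omega)]
      simp only [blockSum, add_lt_iff_neg_left, not_lt_zero, if_false, cond_true,
        add_tsub_cancel_left]
      rw [tensorMat_apply hi hj haj hq, hs'.mem 31 (by decide), hS _ hai _ hp, hS _ haj _ hq]
    -- Contrapositively, a nonzero entry lies in a diagonal block and is reached by the loops of
    -- that block.
    · rintro r c ⟨a, ha, i, hi, j, hj, rfl, rfl⟩
      contrapose!
      rw [stackedBlocks_apply hi, blockSum]
      intro h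
      split_ifs at h with h1 h2 h2
      · obtain ⟨y, hy, z, hz, p, hp, q, hq, rfl, rfl⟩ := exists_of_tensorMat_ne_zero hK h1 h
        exact .inl ⟨a, ha, y, hy, z, hz, p, hp, q, hq, by simp, by simp⟩
      · exact absurd rfl h
      · exact absurd rfl h
      · obtain ⟨y, hy, z, hz, p, hp, q, hq, hi', hc'⟩ :=
          exists_of_tensorMat_ne_zero hL (by omega) h
        refine .inr ⟨a, ha, y, hy, z, hz, p, hp, q, hq, ?_, ?_⟩
        · rw [← hi']; congr 1; omega
        · rw [← hc']; omega
    · intro M hM a ha i hi j hj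
      rw [hM _ _ ⟨a, ha, i, hi, j, hj, rfl, rfl⟩, stackedBlocks_apply hi]
  · intro s₁ hs
    refine ((Fills.seq (tensorSquareProg_fills (o := false) (Φ := fun _ => v)
      ((hs.idx 7 (by decide)).trans h7) ((hs.idx 16 (by decide)).trans h16) hD1 ?_)
      fun s' hs' => tensorSquareProg_fills (o := true)
        ((hs'.idx 8 (by decide)).trans ((hs.idx 8 (by decide)).trans h8))
        ((hs'.idx 9 (by decide)).trans ((hs.idx 9 (by decide)).trans h9)) hE1 ?_).runs_of_zero
      (D := fun r c => r = 0 ∧ c < N) ?_ ?_).mono le_rfl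
      fun M hM i hi => hM 0 i ⟨rfl, hi⟩
    · intro p hp q hq
      have h1 := mul_add_lt_mul hp hq
      have h2 := mul_add_div_mod (p := p) hq
      simp only [cond_false]
      rw [hs.mem 32 (by decide), hx p hp, hx q hq]
      simp [hv, joinVec, h1, tensorSquare, h2]
    · intro p hp q hq
      have h2 := mul_add_div_mod (p := p) hq
      simp only [cond_true]
      rw [hs'.mem 33 (by decide), hs.mem 33 (by decide), hy p hp, hy q hq]
      simp [hv, joinVec, tensorSquare, h2]
    · rw [hs.mem 22 (by decide)]
      exact hmem 22 (by simp)
    · rintro r c ⟨rfl, hc⟩ hS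
      exfalso
      by_cases h : c < D * D
      · exact hS (.inl ⟨c / D, Nat.div_lt_of_lt_mul h, c % D, Nat.mod_lt _ hD1, rfl, by
          rw [Nat.div_add_mod', zero_add]⟩)
      · exact hS (.inr ⟨(c - D * D) / E, Nat.div_lt_of_lt_mul (by omega), (c - D * D) % E,
          Nat.mod_lt _ hE1, rfl, by rw [Nat.div_add_mod']; omega⟩)
  · intro s₁ hs
    refine ((Fills.seq (traceVecProg_fills (o := false) (Φ := fun _ => f)
      ((hs.idx 7 (by decide)).trans h7) ((hs.idx 16 (by decide)).trans h16) hD1 ?_)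
      fun s' hs' => traceVecProg_fills (o := true)
        ((hs'.idx 8 (by decide)).trans ((hs.idx 8 (by decide)).trans h8))
        ((hs'.idx 9 (by decide)).trans ((hs.idx 9 (by decide)).trans h9)) hE1 ?_).runs_of_zero
      (D := fun r c => r = 0 ∧ c < N) ?_ ?_).mono le_rfl
      fun M hM i hi => hM 0 i ⟨rfl, hi⟩
    · intro p hp
      have h1 := mul_add_lt_mul hp hp
      have h2 := mul_add_div_mod (p := p) hp
      simp [hf, joinVec, h1, traceVec, h2]
    · intro p hp
      have h2 := mul_add_div_mod (p := p) hp
      simp [hf, joinVec, traceVec, h2]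
    · rw [hs.mem 23 (by decide)]
      exact hmem 23 (by simp)
    -- A nonzero entry of the trace functional sits at a position `p * D + p`, where quotient and
    -- remainder agree.
    · rintro r c ⟨rfl, hc⟩
      contrapose!
      rw [hf, joinVec]
      intro h
      split_ifs at h with h1
      · have h2 : c / D = c % D := by
          by_contra h2
          simp [traceVec, h2] at h
        refine .inl ⟨c / D, Nat.div_lt_of_lt_mul h1, rfl, ?_⟩
        conv_rhs => rw [zero_add]; arg 2; rw [h2]
        rw [Nat.div_add_mod']
      · have h2 : (c - D * D) / E = (c - D * D) % E := by
          by_contra h2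
          simp [traceVec, h2] at h
        refine .inr ⟨(c - D * D) / E, Nat.div_lt_of_lt_mul (by omega), rfl, ?_⟩
        conv_rhs => arg 2; arg 2; rw [h2]
        rw [Nat.div_add_mod']
        omega

/-- Pass to real coordinates, store the weighted automaton, and test it. -/
def qrwRealifyTestProg : Program :=
  .seq (realMatProg false) (.seq (realMatProg true)
    (.seq (realVecProg false) (.seq (realVecProg true) qrwLoadTestProg)))

/-- A bound for the cost of `qrwRealifyTestProg`. -/
def qrwCost (σ k l K L N : ℕ) : ℕ :=
  124 * (k * k) + (124 * (l * l) + (62 * k + (62 * l +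
    (160 * (σ * (K * (K * (2 * k * (2 * k))))) + 160 * (σ * (L * (L * (2 * l * (2 * l))))) +
      (54 * (2 * k * (2 * k)) + 54 * (2 * l * (2 * l)) +
        (42 * (2 * k) + 42 * (2 * l) + 672 * (σ * N ^ 4)))))))

theorem qrwRealifyTestProg_runs {s : State} {σ K L N : ℕ} (QX : QRW σ K) (QY : QRW σ L)
    (h0 : s.idx 0 = σ) (h3 : s.idx 3 = N) (h4 : s.idx 4 = N + 1) (h5 : s.idx 5 = 2 * K)
    (h6 : s.idx 6 = 2 * L) (h7 : s.idx 7 = 2 * (σ * K)) (h8 : s.idx 8 = 2 * (σ * L))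
    (h9 : s.idx 9 = 2 * (σ * K) * (2 * (σ * K))) (h16 : s.idx 16 = 0) (h17 : s.idx 17 = σ * K)
    (h18 : s.idx 18 = σ * L)
    (hN : 2 * (σ * K) * (2 * (σ * K)) + 2 * (σ * L) * (2 * (σ * L)) = N)
    (hmem : s.mem = (qrwInput QX QY).mem) :
    Runs qrwRealifyTestProg s
      (qrwCost σ (σ * K) (σ * L) (2 * K) (2 * L) N)
      fun m => m 24 0 0 = 0 ↔ QX.prob = QY.prob := by
  have hk := QX.card_edges_pos
  have hl := QY.card_edges_pos
  have hσ : 1 ≤ σ := Nat.pos_of_mul_pos_right hk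
  have hK : 1 ≤ K := Nat.pos_of_mul_pos_left hk
  have hL : 1 ≤ L := Nat.pos_of_mul_pos_left hl
  rw [funext_iff]
  simp only [← QRW.weight_eq_prob]
  refine Runs.seq (realMatProg_runs (o := false) h17 hk) fun s₁ hs₁ hq₁ =>
    Runs.seq (realMatProg_runs (o := true) ((hs₁.idx 18 (by decide)).trans h18) hl)
      fun s₂ hs₂ hq₂ =>
    Runs.seq (realVecProg_runs (o := false)
      ((hs₂.idx 17 (by decide)).trans ((hs₁.idx 17 (by decide)).trans h17)) hk)
      fun s₃ hs₃ hq₃ =>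
    Runs.seq (realVecProg_runs (o := true)
      ((hs₃.idx 18 (by decide)).trans ((hs₂.idx 18 (by decide)).trans
        ((hs₁.idx 18 (by decide)).trans h18))) hl) fun s₄ hs₄ hq₄ => ?_
  simp only [cond_false, cond_true] at hq₁ hq₂ hq₃ hq₄
  have hI : ∀ x ∈ [0, 3, 4, 5, 6, 7, 8, 9, 16], s₄.idx x = s.idx x := by
    intro x hx
    have h : ∀ x ∈ [0, 3, 4, 5, 6, 7, 8, 9, 16], (realMatProg false).keepsIdx x = true ∧
      (realMatProg true).keepsIdx x = true ∧ (realVecProg false).keepsIdx x = true ∧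
      (realVecProg true).keepsIdx x = true := by decide
    obtain ⟨ha, hb, hc, hd⟩ := h x hx
    rw [hs₄.idx x hd, hs₃.idx x hc, hs₂.idx x hb, hs₁.idx x ha]
  have hM : ∀ A ∈ [20, 21, 22, 23, 24], s₄.mem A = (qrwInput QX QY).mem A := by
    intro A hA
    have h : ∀ A ∈ [20, 21, 22, 23, 24], (realMatProg false).keepsMem A = true ∧
      (realMatProg true).keepsMem A = true ∧ (realVecProg false).keepsMem A = true ∧
      (realVecProg true).keepsMem A = true := by decide
    obtain ⟨ha, hb, hc, hd⟩ := h A hA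
    rw [hs₄.mem A hd, hs₃.mem A hc, hs₂.mem A hb, hs₁.mem A ha, hmem]
  refine qrwLoadTestProg_runs ((hI 0 (by simp)).trans h0) ((hI 3 (by simp)).trans h3)
    ((hI 4 (by simp)).trans h4) ((hI 5 (by simp)).trans h5) ((hI 6 (by simp)).trans h6)
    ((hI 7 (by simp)).trans h7) ((hI 8 (by simp)).trans h8) ((hI 9 (by simp)).trans h9)
    ((hI 16 (by simp)).trans h16) hσ (by omega) (by omega) (by ring) (by ring) hN ?_ ?_ ?_ ?_ ?_
  · intro A hA i j
    rw [hM A hA]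
    simp only [List.mem_cons, List.not_mem_nil, or_false] at hA
    rcases hA with rfl | rfl | rfl | rfl | rfl <;> rfl
  · intro i hi p hp
    rw [hs₄.mem 30 (by decide), hs₃.mem 30 (by decide), hs₂.mem 30 (by decide), hq₁ i hi p hp, hmem]
    rfl
  · intro i hi p hp
    rw [hs₄.mem 31 (by decide), hs₃.mem 31 (by decide), hq₂ i hi p hp, hs₁.mem 4 (by decide),
      hs₁.mem 5 (by decide), hmem]
    rfl
  · intro i hi
    rw [hs₄.mem 32 (by decide), hq₃ i hi, hs₂.mem 2 (by decide), hs₂.mem 3 (by decide),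
      hs₁.mem 2 (by decide), hs₁.mem 3 (by decide), hmem]
    rfl
  · intro i hi
    rw [hq₄ i hi, hs₃.mem 6 (by decide), hs₃.mem 7 (by decide), hs₂.mem 6 (by decide),
      hs₂.mem 7 (by decide), hs₁.mem 6 (by decide), hs₁.mem 7 (by decide), hmem]
    rfl

/-- Equivalence test for quantum random walks. -/
def qrwProg : Program :=
  .seq
    (.seq (.setIdx 5 (.mul (.const 2) (.reg 1)))
    (.seq (.setIdx 6 (.mul (.const 2) (.reg 2)))
    (.seq (.setIdx 17 (.mul (.reg 0) (.reg 1)))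
    (.seq (.setIdx 18 (.mul (.reg 0) (.reg 2)))
    (.seq (.setIdx 7 (.mul (.const 2) (.reg 17)))
    (.seq (.setIdx 8 (.mul (.const 2) (.reg 18)))
    (.seq (.setIdx 9 (.mul (.reg 7) (.reg 7)))
    (.seq (.setIdx 3 (.add (.reg 9) (.mul (.reg 8) (.reg 8))))
    (.seq (.setIdx 4 (.add (.reg 3) (.const 1)))
    qrwRealifyTestProg)))))))))
    answerProg

/-- `N = 4k² + 4l² ≤ 8T`, hence `N ^ 4 ≤ 4096 * T ^ 4`, and each of the other terms is bounded by a
multiple of `σ * N ^ 4`. A letter's block is part of all `2k` coordinates, so `K ≤ 2k` is enough.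
The final constant is generous. -/
theorem qrw_cost_le {σ k l K L N T : ℕ} (hσ : 1 ≤ σ) (hk : 1 ≤ k) (hl : 1 ≤ l)
    (hK : K ≤ 2 * k) (hL : L ≤ 2 * l) (hN : 2 * k * (2 * k) + 2 * l * (2 * l) = N)
    (hT : max (k ^ 2) (l ^ 2) ≤ T) :
    qrwCost σ k l K L N + 100 ≤ 20000000 * (σ * T ^ 4) := by
  unfold qrwCost
  have hk2 : k ≤ k * k := Nat.le_mul_self k
  have hl2 : l ≤ l * l := Nat.le_mul_self l
  have hN1 : 1 ≤ N := by nlinarith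
  have hNT : N ≤ 8 * T := by
    have h1 := (le_max_left (k ^ 2) (l ^ 2)).trans hT
    have h2 := (le_max_right (k ^ 2) (l ^ 2)).trans hT
    nlinarith
  have hX : 2 * k * (2 * k) ≤ N := by omega
  have hY : 2 * l * (2 * l) ≤ N := by omega
  have hN2 : N * N ≤ N ^ 4 := by
    rw [← sq]
    exact Nat.pow_le_pow_right hN1 (by norm_num)
  have hNσ : N ≤ σ * N ^ 4 :=
    (Nat.le_mul_self N).trans (hN2.trans (Nat.le_mul_of_pos_left _ hσ))
  have h1 : σ * (K * (K * (2 * k * (2 * k)))) ≤ σ * N ^ 4 := by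
    refine Nat.mul_le_mul_left _ (le_trans ?_ hN2)
    rw [← mul_assoc]
    exact Nat.mul_le_mul ((Nat.mul_le_mul hK hK).trans hX) hX
  have h2 : σ * (L * (L * (2 * l * (2 * l)))) ≤ σ * N ^ 4 := by
    refine Nat.mul_le_mul_left _ (le_trans ?_ hN2)
    rw [← mul_assoc]
    exact Nat.mul_le_mul ((Nat.mul_le_mul hL hL).trans hY) hY
  have h3 : σ * N ^ 4 ≤ 4096 * (σ * T ^ 4) := by
    calc σ * N ^ 4 ≤ σ * (8 * T) ^ 4 := by gcongr
      _ = 4096 * (σ * T ^ 4) := by ring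
  have h4 : 2 * k * (2 * k) = 4 * (k * k) := by ring
  have h5 : 2 * l * (2 * l) = 4 * (l * l) := by ring
  rw [h4] at h1 hX hN ⊢
  rw [h5] at h2 hY hN ⊢
  omega

theorem qrwProg_decidesWithin {σ K L : ℕ} (QX : QRW σ K) (QY : QRW σ L) :
    DecidesWithin qrwProg (qrwInput QX QY)
      (20000000 * (σ * max (QRW.stateSpaceDim σ K) (QRW.stateSpaceDim σ L) ^ 4))
      (QX.prob = QY.prob) := by
  have hk := QX.card_edges_pos
  have hl := QY.card_edges_pos
  have hσ : 1 ≤ σ := Nat.pos_of_mul_pos_right hk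
  refine Runs.decidesWithin
    (Runs.setIdx_seq' fun s₁ m₁ i₁ => Runs.setIdx_seq' fun s₂ m₂ i₂ =>
    Runs.setIdx_seq' fun s₃ m₃ i₃ => Runs.setIdx_seq' fun s₄ m₄ i₄ =>
    Runs.setIdx_seq' fun s₅ m₅ i₅ => Runs.setIdx_seq' fun s₆ m₆ i₆ =>
    Runs.setIdx_seq' fun s₇ m₇ i₇ => Runs.setIdx_seq' fun s₈ m₈ i₈ =>
    Runs.setIdx_seq' fun s₉ m₉ i₉ => qrwRealifyTestProg_runs QX QY
      ?_ ?_ ?_ ?_ ?_ ?_ ?_ ?_ ?_ ?_ ?_ rfl ?_) ?_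
  iterate 11
    · simp [i₁, i₂, i₃, i₄, i₅, i₆, i₇, i₈, i₉, IExpr.eval, Function.update, qrwInput, inputIdx]
  · rw [m₉, m₈, m₇, m₆, m₅, m₄, m₃, m₂, m₁]
  · have := qrw_cost_le (K := 2 * K) (L := 2 * L) hσ hk hl
      (Nat.mul_le_mul_left 2 (Nat.le_mul_of_pos_left K hσ))
      (Nat.mul_le_mul_left 2 (Nat.le_mul_of_pos_left L hσ)) rfl
      (max_le_max (QRW.sq_le_stateSpaceDim σ K) (QRW.sq_le_stateSpaceDim σ L))
    refine le_trans ?_ this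
    simp only [IExpr.cost]
    omega

end RealRAM

theorem theorem1 :
    (∃ (P : RealRAM.Program) (C : ℕ), ∀ (σ nX nY : ℕ) (MX : HMM σ nX) (MY : HMM σ nY),
      RealRAM.DecidesWithin P (RealRAM.hmmInput MX MY)
        (C * (σ * max nX nY ^ 4))
        (MX.prob = MY.prob)) ∧
    (∃ (P : RealRAM.Program) (C : ℕ), ∀ (σ KX KY : ℕ) (QX : QRW σ KX) (QY : QRW σ KY),
      RealRAM.DecidesWithin P (RealRAM.qrwInput QX QY)
        (C * (σ * max (QRW.stateSpaceDim σ KX) (QRW.stateSpaceDim σ KY) ^ 4))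
        (QX.prob = QY.prob)) :=
  ⟨⟨RealRAM.hmmProg, 20000, fun _ _ _ MX MY => RealRAM.hmmProg_decidesWithin MX MY⟩,
    ⟨RealRAM.qrwProg, 20000000, fun _ _ _ QX QY => RealRAM.qrwProg_decidesWithin QX QY⟩⟩
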